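/- **Setting.** Let $A:\operatorname{dom}(A)\subseteq\mathcal H\to\mathcal H$ be a (possibly unbounded) selfadjoint operator in a complex Hilbert space $\mathcal H$ with spectrum $\Sigma(A)$ and resolvent $R(z)=(z-A)^{-1}$. Let $\Lambda\subset\Sigma(A)$ be a nonempty finite set of eigenvalues of finite multiplicity, and let $E$ be the span of all eigenvectors of $A$ with eigenvalues in $\Lambda$. Let $N\in\mathbb N$, $w_0,\dots,w_N\in\mathbb C$, $z_0,\dots,z_{N-1}\in\mathbb C$, $$r_N(\xi)=w_N+\sum_{k=0}^{N-1}w_k(z_k-\xi)^{-1},\qquad W=\sum_{k=0}^N|w_k| .$$ Assume: 1. $z_k\notin\overline{\Sigma(A)}$ for all $k$, and there are $y\in\mathbb R$ and $\gamma,\delta>0$ such that $\Lambda\subset I=\{x\in\mathbb R:|x-y|\le\gamma\}$, $\Sigma(A)\setminus\Lambda\subset O=\{x\in\mathbb R:|x-y|\ge(1+\delta)\gamma\}$, and $\hat\kappa=\sup_{O}|r_N|/\inf_{I}|r_N|<1$ (with nonzero denominator; $|r_N|=\infty$ at poles). 2. $\mathcal V\subseteq\mathcal H$ is a Hilbert space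 with $E\subseteq\mathcal V$, there is $C_{\mathcal V}>0$ with $\|u\|_{\mathcal H}\le C_{\mathcal V}\|u\|_{\mathcal V}$ for all $u\in\mathcal V$, and $R(z_k)\mathcal V\subseteq\mathcal V$ for $k=0,\dots,N-1$. 3. For each $h$ in a set of positive numbers accumulating at $0$, $\mathcal V_h\subseteq\mathcal V$ is a finite-dimensional subspace and $R_h(z_k):\mathcal H\to\mathcal V_h$, $k=0,\dots,N-1$, are linear; the operators $R(z_k)$ and $R_h(z_k)$ are bounded in $\mathcal V$, and $\lim_{h\to0}\|R_h(z_k)-R(z_k)\|_{\mathcal V}=0$ for every $k$. Regard $S_N=w_N+\sum_{k<N}w_kR(z_k)$ and $S_N^h=w_N+\sum_{k<N}w_kR_h(z_k)$ as bounded operators on $\mathcal V$. Put $M=\{r_N(\lambda):\lambda\in\Lambda\}$ and $\mu_*=\sup\{|\mu|:\mu\in\Sigma(S_N)\setminus M\}$ (with $\sup\emptyset=0$). Let $\Theta$ be a positively oriented simple closed rectifiable curve in $\mathbb C$ that encloses $M$, lies strictly outside the circle of radius $\mu_*$ about $0$, and encloses no other element of $\Sigma(S_N)$. When $\Theta$ lies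 in the resolvent set of $S_N^h$, put $P_h=\frac1{2\pi\mathrm i}\oint_\Theta(z-S_N^h)^{-1}\,dz$ and $E_h=\operatorname{ran}P_h$. For subspaces $M_1,M_2$ of $\mathcal V$ let $$\operatorname{gap}_{\mathcal V}(M_1,M_2)=\max\Big[\sup_{m\in M_1,\|m\|_{\mathcal V}=1}\operatorname{dist}_{\mathcal V}(m,M_2),\ \sup_{m\in M_2,\|m\|_{\mathcal V}=1}\operatorname{dist}_{\mathcal V}(m,M_1)\Big].$$ **Theorem.** Under these assumptions there are $C_N>0$ and $h_0>0$, independent of $h$, such that for all $h<h_0$ the curve $\Theta$ lies in the resolvent set of $S_N^h$ (so that $E_h$ is defined) and $$\operatorname{gap}_{\mathcal V}(E,E_h)\le C_N\,W\max_{k=0,\dots,N-1}\big\|[R(z_k)-R_h(z_k)]\big|_E\big\|_{\mathcal V}.$$ In particular $\lim_{h\to0}\operatorname{gap}_{\mathcal V}(E,E_h)=0$. -/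

import Mathlib

open Set Filter Topology

noncomputable section

namespace FilteredIteration

section Unbounded

variable {H : Type*} [NormedAddCommGroup H] [InnerProductSpace ℂ H]

/-- `R` is the bounded two-sided inverse of `z - A : dom A → H`. -/
def IsResolventAt (A : H →ₗ.[ℂ] H) (z : ℂ) (R : H →L[ℂ] H) : Prop :=
  (∀ u : H, ∃ x : A.domain, (x : H) = R u ∧ z • (x : H) - A x = u) ∧
    ∀ x : A.domain, R (z • (x : H) - A x) = x

/-- The resolvent set of an unbounded operator. -/
def resolventSetOf (A : H →ₗ.[ℂ] H) : Set ℂ := {z | ∃ R, IsResolventAt A z R}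

/-- The spectrum `Σ(A)` of an unbounded operator. -/
def spectrumOf (A : H →ₗ.[ℂ] H) : Set ℂ := (resolventSetOf A)ᶜ

open Classical in
/-- The resolvent `R(z) = (z - A)⁻¹` (zero if `z` is not in the resolvent set). -/
def resolventOf (A : H →ₗ.[ℂ] H) (z : ℂ) : H →L[ℂ] H :=
  if h : ∃ R, IsResolventAt A z R then h.choose else 0

/-- The set of all `u ∈ dom A` with `A u = lam u` (including `0`). -/
def eigenvectors (A : H →ₗ.[ℂ] H) (lam : ℝ) : Set H :=
  {u | ∃ x : A.domain, (x : H) = u ∧ A x = (lam : ℂ) • (x : H)}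

/-- The exact eigenspace `E`: the span of all eigenvectors for eigenvalues in `Λ`. -/
def exactEigenspace (A : H →ₗ.[ℂ] H) (Λ : Finset ℝ) : Submodule ℂ H :=
  Submodule.span ℂ (⋃ lam ∈ Λ, eigenvectors A lam)

/-- `Λ` is a nonempty finite collection of eigenvalues of `A` of finite multiplicity. -/
structure IsEigenvalueCluster (A : H →ₗ.[ℂ] H) (Λ : Finset ℝ) : Prop where
  nonempty : Λ.Nonempty
  eigenvalue : ∀ lam ∈ Λ, ∃ u ∈ eigenvectors A lam, u ≠ 0
  finite_mult : ∀ lam ∈ Λ,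
    FiniteDimensional ℂ (Submodule.span ℂ (eigenvectors A lam))

end Unbounded

/-- The data `w_0, …, w_N` and `z_0, …, z_{N-1}` of the rational function
`r_N(ξ) = w_N + ∑_{k<N} w_k (z_k - ξ)⁻¹`. -/
structure RationalFilter (N : ℕ) where
  w : Fin (N + 1) → ℂ
  z : Fin N → ℂ

namespace RationalFilter

variable {N : ℕ} (F : RationalFilter N)

/-- The rational function `r_N`. -/
def r (ξ : ℂ) : ℂ := F.w (Fin.last N) + ∑ k : Fin N, F.w k.castSucc * (F.z k - ξ)⁻¹

/-- `W = ∑_{k=0}^{N} |w_k|`. -/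
def W : ℝ := ∑ k : Fin (N + 1), ‖F.w k‖

/-- `sup |r_N|` over `O = {x ∈ ℝ : |x - y| ≥ (1+δ)γ}`. The finitely many nodes are left out, where
the formula for `r_N` has no meaning; as `O` has no isolated points this does not change the
supremum of the rational function `|r_N|` with its value `∞` at the poles. -/
def supOuter (y γ δ : ℝ) : ENNReal :=
  ⨆ x ∈ {x : ℝ | (1 + δ) * γ ≤ |x - y| ∧ ∀ k, F.z k ≠ (x : ℂ)}, ‖F.r (x : ℂ)‖ₑ

/-- `inf |r_N|` over `I = {x ∈ ℝ : |x - y| ≤ γ}`, the nodes being left out as in `supOuter`. -/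
def infInner (y γ : ℝ) : ENNReal :=
  ⨅ x ∈ {x : ℝ | |x - y| ≤ γ ∧ ∀ k, F.z k ≠ (x : ℂ)}, ‖F.r (x : ℂ)‖ₑ

/-- The contraction factor `κ̂`. -/
def kappaHat (y γ δ : ℝ) : ENNReal := F.supOuter y γ δ / F.infInner y γ

/-- The filter operator `w_N + ∑_{k<N} w_k T_k` obtained from bounded operators `T_k` that stand for
the resolvents at the nodes `z_k`. -/
def op {V : Type*} [NormedAddCommGroup V] [NormedSpace ℂ V] (T : Fin N → V →L[ℂ] V) :
    V →L[ℂ] V :=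
  F.w (Fin.last N) • ContinuousLinearMap.id ℂ V + ∑ k : Fin N, F.w k.castSucc • T k

end RationalFilter

/-- The spectral separation assumption on the filter and the cluster. The condition
`infInner ≠ 0` only excludes the undefined quotient `0 / 0`. -/
def SeparatesSpectrum {H : Type*} [NormedAddCommGroup H] [InnerProductSpace ℂ H]
    (A : H →ₗ.[ℂ] H) (Λ : Finset ℝ) {N : ℕ} (F : RationalFilter N) : Prop :=
  (∃ y γ δ : ℝ, 0 < γ ∧ 0 < δ ∧
    (∀ lam ∈ Λ, |lam - y| ≤ γ) ∧
    (∀ ξ ∈ spectrumOf A, (∀ lam ∈ Λ, ξ ≠ (lam : ℂ)) →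
      ∃ x : ℝ, ξ = (x : ℂ) ∧ (1 + δ) * γ ≤ |x - y|) ∧
    F.infInner y γ ≠ 0 ∧ F.kappaHat y γ δ < 1) ∧
  ∀ k, F.z k ∉ closure (spectrumOf A)

/-- The assumption on the Hilbert space `V ⊆ H`, the inclusion being the injective linear map `ι`:
`E ⊆ V`, `‖u‖_H ≤ C ‖u‖_V` on `V`, and `R(z_k) V ⊆ V` for the nodes `z_k`. -/
structure IsIntermediateSpace {H V : Type*} [NormedAddCommGroup H] [InnerProductSpace ℂ H]
    [NormedAddCommGroup V] [InnerProductSpace ℂ V]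
    (A : H →ₗ.[ℂ] H) (Λ : Finset ℝ) {N : ℕ} (F : RationalFilter N) (ι : V →ₗ[ℂ] H) : Prop where
  injective : Function.Injective ι
  eigenspace_le : exactEigenspace A Λ ≤ LinearMap.range ι
  bounded : ∃ C : ℝ, 0 < C ∧ ∀ u : V, ‖ι u‖ ≤ C * ‖u‖
  invariant : ∀ (k : Fin N) (v : V), resolventOf A (F.z k) (ι v) ∈ LinearMap.range ι

/-- The assumption on the discrete resolvents `R_h(z) : H → V_h`, for `h` in a set `J` of positive
numbers. The operators `R(z_k)` and `R_h(z_k)` are bounded in `V`: their restrictions to `V` are the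
bounded operators `RV k` and `RhV h k`, and these satisfy `‖R_h(z_k) - R(z_k)‖_V → 0` as `h → 0`. -/
structure IsResolventDiscretization {H V : Type*} [NormedAddCommGroup H] [InnerProductSpace ℂ H]
    [NormedAddCommGroup V] [InnerProductSpace ℂ V]
    (A : H →ₗ.[ℂ] H) {N : ℕ} (F : RationalFilter N) (ι : V →ₗ[ℂ] H) (J : Set ℝ)
    (Vh : J → Submodule ℂ V) (Rh : J → ℂ → H →ₗ[ℂ] V)
    (RV : Fin N → V →L[ℂ] V) (RhV : J → Fin N → V →L[ℂ] V) : Prop where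
  finiteDimensional : ∀ h, FiniteDimensional ℂ (Vh h)
  range_le : ∀ h k, LinearMap.range (Rh h (F.z k)) ≤ Vh h
  exact_restrict : ∀ k v, ι (RV k v) = resolventOf A (F.z k) (ι v)
  discrete_restrict : ∀ h k v, RhV h k v = Rh h (F.z k) (ι v)
  tendsto : ∀ k, Tendsto (fun h : J => ‖RhV h k - RV k‖) (comap ((↑) : J → ℝ) (𝓝 0)) (𝓝 0)

/-- `∮ f(z) dz` along the curve `Θ : [0,1] → ℂ`. -/
def contourIntegral {B : Type*} [NormedAddCommGroup B] [NormedSpace ℂ B]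
    (Θ : ℝ → ℂ) (f : ℂ → B) : B :=
  ∫ t in (0 : ℝ)..1, deriv Θ t • f (Θ t)

/-- The winding number `(2πi)⁻¹ ∮ (z - ξ)⁻¹ dz`. -/
def windingNumber (Θ : ℝ → ℂ) (ξ : ℂ) : ℂ :=
  (2 * Real.pi * Complex.I)⁻¹ • contourIntegral Θ (fun z => (z - ξ)⁻¹)

/-- A simple closed rectifiable curve, in a Lipschitz parametrization over `[0,1]` (which every
rectifiable curve has). -/
structure IsSimpleRectifiable (Θ : ℝ → ℂ) : Prop where
  lipschitz : ∃ K, LipschitzOnWith K Θ (Icc 0 1)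
  closed : Θ 0 = Θ 1
  simple : InjOn Θ (Ico 0 1)

/-- The contours `Θ` used to define spectral projectors of the filter. Here `S` is a bounded
operator, `M` a set of its eigenvalues, and `μ_* = sup {|μ| : μ ∈ Σ(S) \ M}` (zero if that set is
empty): `Θ` encloses `M` counterclockwise, lies strictly outside the circle of radius `μ_*` about
`0`, and encloses no other element of the spectrum of `S`. -/
structure IsFilterContour {V : Type*} [NormedAddCommGroup V] [NormedSpace ℂ V]
    (S : V →L[ℂ] V) (M : Set ℂ) (Θ : ℝ → ℂ) : Prop where
  curve : IsSimpleRectifiable Θ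
  avoids : ∀ t ∈ Icc (0 : ℝ) 1, Θ t ∉ M
  encloses : ∀ μ ∈ M, windingNumber Θ μ = 1
  outside : ∀ t ∈ Icc (0 : ℝ) 1, sSup ((fun μ : ℂ => ‖μ‖) '' (spectrum ℂ S \ M)) < ‖Θ t‖
  excludes : ∀ μ ∈ spectrum ℂ S \ M, windingNumber Θ μ = 0

/-- The spectral projector `(2πi)⁻¹ ∮ (z - S)⁻¹ dz`. -/
def spectralProjector {V : Type*} [NormedAddCommGroup V] [NormedSpace ℂ V]
    (Θ : ℝ → ℂ) (S : V →L[ℂ] V) : V →L[ℂ] V :=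
  (2 * Real.pi * Complex.I)⁻¹ • contourIntegral Θ (fun z => resolvent S z)

/-- The limit space `E_h = ran P_h`, for the spectral projector `P_h` of `S = S_N^h`. -/
def limitSpace {V : Type*} [NormedAddCommGroup V] [NormedSpace ℂ V]
    (Θ : ℝ → ℂ) (S : V →L[ℂ] V) : Submodule ℂ V :=
  LinearMap.range (spectralProjector Θ S : V →ₗ[ℂ] V)

/-- `sup {dist (m, L) : m ∈ M, ‖m‖ = 1}` (zero if `M = 0`). -/
def oneSidedGap {V : Type*} [NormedAddCommGroup V] [NormedSpace ℂ V] (M L : Submodule ℂ V) : ℝ :=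
  sSup ((fun m : V => Metric.infDist m (L : Set V)) '' {m : V | m ∈ M ∧ ‖m‖ = 1})

/-- The gap between two linear subspaces. -/
def gap {V : Type*} [NormedAddCommGroup V] [NormedSpace ℂ V] (M L : Submodule ℂ V) : ℝ :=
  max (oneSidedGap M L) (oneSidedGap L M)

end FilteredIteration

end

namespace FilteredIteration

/-! ### Integration along Lipschitz closed curves. -/

section Contour

open MeasureTheory
open scoped NNReal

variable {B : Type*} [NormedAddCommGroup B] [NormedSpace ℂ B]
variable {B' : Type*} [NormedAddCommGroup B'] [NormedSpace ℂ B']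
variable {Θ : ℝ → ℂ} {K : ℝ≥0}

/-! The theorem compares two Riesz projectors, `P` of `S_N` and `P_h` of `S_N^h`, once `ran P = E`
is known. That identification is the delicate point, since on `V` the operator `S_N` need not be
normal and its spectrum may differ from that on `H`.

On `H`, every `R(z_k)` is a function of one bounded normal resolvent, so the continuous functional
calculus gives a projection `Q` onto `E` that commutes with the filter and satisfies `‖S_N (1 - Q)‖
< |r_N(λ)|` on the cluster (`SeparatesSpectrum.exists_projection`). As `E` is finite-dimensional and
contained in `V`, `Q` restricts to `V`. The contour isolates each point of `M` in the spectrum of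
`S_N` on `V`; on the kernel of `Q` the residue of the resolvent there vanishes, because the
inclusion into `H` is injective and carries it to an integral of a holomorphic resolvent
(`mem_resolventSet_of_intertwining`). The rest of the spectrum lies in a disc about which the
contour does not wind, so `P` has no component in the kernel of `Q`
(`IsFilterContour.spectralProjector_mem`). On eigenvectors in `E`, `P` is multiplication by the
winding number 1.

For `P_h`, a Neumann series bounds the resolvents uniformly on the contour. The identity `R_X - R_S
= R_X (X - S) R_S` and the invariance of `E` under `R_S` bound `(P_h - P)|_E` by the error of the
filter on `E` alone (`norm_spectralProjector_sub_apply_le`). Idempotence of `P_h` comes from linear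
algebra: `S_N^h - w_N` has finite rank, and `P_h` multiplies generalized eigenvectors by winding
numbers, which are 0 or 1 by upper semicontinuity of the spectrum. Then `gap_range_le` turns the
bound on `E` into a bound for both halves of the gap. -/

lemma ae_norm_deriv_le (hΘ : LipschitzOnWith K Θ (Icc 0 1)) :
    ∀ᵐ t : ℝ, t ∈ uIoc (0 : ℝ) 1 → ‖deriv Θ t‖ ≤ K := by
  have h1 : ∀ᵐ t : ℝ, t ≠ 1 := by simp [ae_iff, measure_singleton]
  filter_upwards [h1] with t ht1 ht
  rw [uIoc_of_le zero_le_one] at ht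
  exact norm_deriv_le_of_lipschitzOn (Icc_mem_nhds ht.1 (lt_of_le_of_ne ht.2 ht1)) hΘ

lemma intervalIntegrable_deriv_of_lipschitzOn (hΘ : LipschitzOnWith K Θ (Icc 0 1)) :
    IntervalIntegrable (deriv Θ) volume 0 1 := by
  rw [intervalIntegrable_iff]
  refine Measure.integrableOn_of_bounded (M := K) (by simp)
    (measurable_deriv Θ).aestronglyMeasurable ?_
  rw [ae_restrict_iff' measurableSet_uIoc]
  exact ae_norm_deriv_le hΘ

lemma intervalIntegrable_contour (hΘ : LipschitzOnWith K Θ (Icc 0 1)) {f : ℂ → B}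
    (hf : ContinuousOn (fun t => f (Θ t)) (Icc 0 1)) :
    IntervalIntegrable (fun t => deriv Θ t • f (Θ t)) volume 0 1 :=
  (intervalIntegrable_deriv_of_lipschitzOn hΘ).smul_continuousOn
    (by rwa [uIcc_of_le zero_le_one])

lemma contourIntegral_congr {f g : ℂ → B} (h : ∀ t ∈ Icc (0 : ℝ) 1, f (Θ t) = g (Θ t)) :
    contourIntegral Θ f = contourIntegral Θ g := by
  refine intervalIntegral.integral_congr fun t ht => ?_
  rw [uIcc_of_le zero_le_one] at ht
  simp only [h t ht]

lemma contourIntegral_add (hΘ : LipschitzOnWith K Θ (Icc 0 1)) {f g : ℂ → B}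
    (hf : ContinuousOn (fun t => f (Θ t)) (Icc 0 1))
    (hg : ContinuousOn (fun t => g (Θ t)) (Icc 0 1)) :
    contourIntegral Θ (fun z => f z + g z) = contourIntegral Θ f + contourIntegral Θ g := by
  simp only [contourIntegral, smul_add]
  exact intervalIntegral.integral_add (intervalIntegrable_contour hΘ hf)
    (intervalIntegrable_contour hΘ hg)

lemma contourIntegral_sub (hΘ : LipschitzOnWith K Θ (Icc 0 1)) {f g : ℂ → B}
    (hf : ContinuousOn (fun t => f (Θ t)) (Icc 0 1))
    (hg : ContinuousOn (fun t => g (Θ t)) (Icc 0 1)) :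
    contourIntegral Θ (fun z => f z - g z) = contourIntegral Θ f - contourIntegral Θ g := by
  simp only [contourIntegral, smul_sub]
  exact intervalIntegral.integral_sub (intervalIntegrable_contour hΘ hf)
    (intervalIntegrable_contour hΘ hg)

lemma contourIntegral_smul_const [CompleteSpace B] (f : ℂ → ℂ) (b : B) :
    contourIntegral Θ (fun z => f z • b) = contourIntegral Θ f • b := by
  simp only [contourIntegral, ← smul_assoc]
  exact intervalIntegral.integral_smul_const _ _

lemma map_contourIntegral [CompleteSpace B] [CompleteSpace B']
    (hΘ : LipschitzOnWith K Θ (Icc 0 1)) (φ : B →L[ℂ] B')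
    {f : ℂ → B} (hf : ContinuousOn (fun t => f (Θ t)) (Icc 0 1)) :
    φ (contourIntegral Θ f) = contourIntegral Θ (fun z => φ (f z)) := by
  simp only [contourIntegral, ← φ.map_smul]
  exact (φ.intervalIntegral_comp_comm (intervalIntegrable_contour hΘ hf)).symm

lemma norm_contourIntegral_le (hΘ : LipschitzOnWith K Θ (Icc 0 1)) {f : ℂ → B} {C : ℝ}
    (hf : ∀ t ∈ Icc (0 : ℝ) 1, ‖f (Θ t)‖ ≤ C) : ‖contourIntegral Θ f‖ ≤ K * C := by
  have := intervalIntegral.norm_integral_le_of_norm_le_const_ae (a := 0) (b := 1)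
    (f := fun t => deriv Θ t • f (Θ t)) (C := K * C) ?_
  · simpa [contourIntegral] using this
  · filter_upwards [ae_norm_deriv_le hΘ] with t ht ht'
    rw [norm_smul]
    have h1 : t ∈ Icc (0 : ℝ) 1 := by
      rw [uIoc_of_le zero_le_one] at ht'
      exact Ioc_subset_Icc_self ht'
    exact mul_le_mul (ht ht') (hf t h1) (norm_nonneg _) K.2

/-- The integral of a complex derivative along a closed Lipschitz curve vanishes. -/
lemma contourIntegral_eq_zero_of_hasDerivAt [CompleteSpace B]
    (hΘ : LipschitzOnWith K Θ (Icc 0 1)) (hclosed : Θ 0 = Θ 1) {U : Set ℂ} (hU : IsOpen U)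
    (hΘU : ∀ t ∈ Icc (0 : ℝ) 1, Θ t ∈ U) {G g : ℂ → B}
    (hG : ∀ z ∈ U, HasDerivAt G (g z) z) : contourIntegral Θ g = 0 := by
  have hdiff : DifferentiableOn ℂ G U := fun z hz => (hG z hz).differentiableAt.differentiableWithinAt
  -- Strict differentiability makes `G` locally Lipschitz, hence `G ∘ Θ` Lipschitz on the compact
  -- interval.
  have hstrict : ∀ z ∈ U, HasStrictDerivAt G (g z) z := fun z hz => by
    have h := (hdiff.contDiffOn (n := 1) hU).contDiffAt (hU.mem_nhds hz)
    exact h.hasStrictDerivAt' (hG z hz) (by simp)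
  have hgc : ContinuousOn g U := by
    have h := (hdiff.contDiffOn (n := 1) hU).continuousOn_deriv_of_isOpen hU (by simp)
    exact h.congr fun z hz => ((hG z hz).deriv).symm
  have hgΘ : ContinuousOn (fun t => g (Θ t)) (Icc 0 1) := hgc.comp hΘ.continuousOn hΘU
  have hloc : LocallyLipschitzOn (Icc (0 : ℝ) 1) (fun t => G (Θ t)) := by
    intro t ht
    obtain ⟨L, s, hs, hL⟩ := (hstrict _ (hΘU t ht)).hasStrictFDerivAt.exists_lipschitzOnWith
    have hpre : Θ ⁻¹' s ∈ 𝓝[Icc 0 1] t := (hΘ.continuousOn t ht).preimage_mem_nhdsWithin hs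
    refine ⟨L * K, Θ ⁻¹' s ∩ Icc 0 1, inter_mem hpre self_mem_nhdsWithin, ?_⟩
    exact hL.comp (hΘ.mono inter_subset_right) (fun x hx => hx.1)
  obtain ⟨L, hL⟩ := hloc.exists_lipschitzOnWith_of_compact isCompact_Icc
  have hint := intervalIntegrable_contour hΘ hgΘ
  obtain ⟨C, hC⟩ := isCompact_Icc.exists_bound_of_continuousOn hgΘ
  have hC0 : 0 ≤ C := (norm_nonneg _).trans (hC 0 (by simp))
  have hLint : LipschitzOnWith (K * C.toNNReal)
      (fun x : ℝ => ∫ t in (0 : ℝ)..x, deriv Θ t • g (Θ t)) (Icc 0 1) := by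
    refine LipschitzOnWith.of_dist_le_mul fun x hx y hy => ?_
    have hsub : ∀ {u v : ℝ}, u ∈ Icc (0 : ℝ) 1 → v ∈ Icc (0 : ℝ) 1 →
        IntervalIntegrable (fun t => deriv Θ t • g (Θ t)) volume u v := fun hu hv =>
      hint.mono_set (by rw [uIcc_of_le (zero_le_one' ℝ)]; exact uIcc_subset_Icc hu hv)
    have h0 : (0 : ℝ) ∈ Icc (0 : ℝ) 1 := by simp
    rw [dist_eq_norm, intervalIntegral.integral_interval_sub_left (hsub h0 hx) (hsub h0 hy),
      Real.dist_eq]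
    refine intervalIntegral.norm_integral_le_of_norm_le_const_ae ?_
    filter_upwards [ae_norm_deriv_le hΘ] with t ht ht'
    have h1 : t ∈ Ioc (0 : ℝ) 1 := by
      rcases mem_uIoc.1 ht' with h | h
      · exact ⟨hy.1.trans_lt h.1, h.2.trans hx.2⟩
      · exact ⟨hx.1.trans_lt h.1, h.2.trans hy.2⟩
    rw [norm_smul]
    have h2 := ht (by rwa [uIoc_of_le zero_le_one])
    have h3 := hC t (Ioc_subset_Icc_self h1)
    push_cast
    rw [Real.coe_toNNReal _ hC0]
    exact mul_le_mul h2 h3 (norm_nonneg _) K.2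
  -- The fundamental theorem in its absolutely continuous form: this difference has derivative zero
  -- almost everywhere, so it is constant.
  have hac : AbsolutelyContinuousOnInterval
      (fun x : ℝ => G (Θ x) - ∫ t in (0 : ℝ)..x, deriv Θ t • g (Θ t)) 0 1 :=
    LipschitzOnWith.absolutelyContinuousOnInterval (K := L + K * C.toNNReal)
      (by rw [uIcc_of_le (zero_le_one' ℝ)]; exact hL.sub hLint)
  obtain ⟨c, hc⟩ := hac.const_of_ae_hasDerivAt_zero (by
    have h0 : ∀ᵐ t : ℝ, t ≠ 0 := by simp [ae_iff, measure_singleton]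
    have h1 : ∀ᵐ t : ℝ, t ≠ 1 := by simp [ae_iff, measure_singleton]
    filter_upwards [h0, h1, hΘ.ae_differentiableWithinAt_of_mem (μ := volume),
      hint.ae_hasDerivAt_integral] with t ht0 ht1 htd hti ht
    have hti' := hti ht 0 (by simp)
    rw [uIcc_of_le zero_le_one] at ht
    have hd : HasDerivAt Θ (deriv Θ t) t := ((htd ht).differentiableAt
      (Icc_mem_nhds (lt_of_le_of_ne ht.1 (Ne.symm ht0)) (lt_of_le_of_ne ht.2 ht1))).hasDerivAt
    have h2 := (hG _ (hΘU t ht)).scomp t hd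
    have h3 := h2.sub hti'
    rwa [sub_self] at h3)
  have ha := hc 0 (by simp)
  have hb := hc 1 (by simp)
  simp only [intervalIntegral.integral_same, sub_zero] at ha
  rw [ha.symm, hclosed] at hb
  simpa [contourIntegral] using hb

/-- Along the curve `(z - ξ) / (z - ξ₀)` stays in the unit disc about 1, so its principal logarithm
is a primitive of the difference of the two integrands. -/
lemma windingNumber_eq_of_norm_sub_lt (hΘ : LipschitzOnWith K Θ (Icc 0 1)) (hclosed : Θ 0 = Θ 1)
    {ξ ξ₀ : ℂ} (h : ∀ t ∈ Icc (0 : ℝ) 1, ‖ξ - ξ₀‖ < ‖Θ t - ξ₀‖) :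
    windingNumber Θ ξ = windingNumber Θ ξ₀ := by
  have hU : IsOpen {z : ℂ | ‖ξ - ξ₀‖ < ‖z - ξ₀‖} :=
    isOpen_lt continuous_const (by fun_prop)
  have hne₀ : ∀ z : ℂ, ‖ξ - ξ₀‖ < ‖z - ξ₀‖ → z - ξ₀ ≠ 0 := fun z hz =>
    norm_pos_iff.1 ((norm_nonneg _).trans_lt hz)
  have hne : ∀ z : ℂ, ‖ξ - ξ₀‖ < ‖z - ξ₀‖ → z - ξ ≠ 0 := fun z hz hzero => by
    rw [sub_eq_zero.1 hzero] at hz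
    exact lt_irrefl _ hz
  have hc : ∀ η : ℂ, (∀ t ∈ Icc (0 : ℝ) 1, Θ t - η ≠ 0) →
      ContinuousOn (fun t => (Θ t - η)⁻¹) (Icc 0 1) := fun η hη =>
    (hΘ.continuousOn.sub continuousOn_const).inv₀ hη
  have key : contourIntegral Θ (fun z => (z - ξ)⁻¹ - (z - ξ₀)⁻¹) = 0 := by
    refine contourIntegral_eq_zero_of_hasDerivAt hΘ hclosed hU h
      (G := fun z => Complex.log ((z - ξ) / (z - ξ₀))) fun z hz => ?_
    have h0 := hne₀ z hz
    have h1 := hne z hz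
    have hslit : (z - ξ) / (z - ξ₀) ∈ Complex.slitPlane := by
      have : (z - ξ) / (z - ξ₀) = 1 + (-(ξ - ξ₀) / (z - ξ₀)) := by field_simp; ring
      rw [this]
      refine Complex.mem_slitPlane_of_norm_lt_one ?_
      rw [norm_div, norm_neg, div_lt_one (norm_pos_iff.2 h0)]
      exact hz
    have hd : HasDerivAt (fun z : ℂ => (z - ξ) / (z - ξ₀)) _ z :=
      ((hasDerivAt_id' z).sub_const ξ).div ((hasDerivAt_id' z).sub_const ξ₀) h0
    refine (hd.clog hslit).congr_deriv ?_
    field_simp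
  rw [contourIntegral_sub hΘ (hc ξ fun t ht => hne _ (h t ht))
    (hc ξ₀ fun t ht => hne₀ _ (h t ht)), sub_eq_zero] at key
  rw [windingNumber, windingNumber, key]

lemma contourIntegral_inv_sub (Θ : ℝ → ℂ) (ξ : ℂ) :
    contourIntegral Θ (fun z => (z - ξ)⁻¹) = (2 * Real.pi * Complex.I) * windingNumber Θ ξ := by
  rw [windingNumber, smul_eq_mul, mul_inv_cancel_left₀ Complex.two_pi_I_ne_zero]

lemma contourIntegral_inv_sub_pow (hΘ : LipschitzOnWith K Θ (Icc 0 1)) (hclosed : Θ 0 = Θ 1)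
    {ξ : ℂ} (hξ : ∀ t ∈ Icc (0 : ℝ) 1, Θ t ≠ ξ) (n : ℕ) :
    contourIntegral Θ (fun z => ((z - ξ)⁻¹) ^ (n + 2)) = 0 := by
  refine contourIntegral_eq_zero_of_hasDerivAt hΘ hclosed (U := {ξ}ᶜ) isOpen_compl_singleton
    hξ (G := fun z => -((n : ℂ) + 1)⁻¹ * ((z - ξ)⁻¹) ^ (n + 1)) fun z hz => ?_
  have hz' : z - ξ ≠ 0 := sub_ne_zero.2 hz
  have hd := ((((hasDerivAt_id z).sub_const ξ).inv hz').pow (n + 1)).const_mul (-((n : ℂ) + 1)⁻¹)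
  refine hd.congr_deriv ?_
  have : (n : ℂ) + 1 ≠ 0 := Nat.cast_add_one_ne_zero n
  simp only [id, Nat.add_sub_cancel, Pi.inv_apply]
  push_cast
  rw [pow_add _ n 2]
  field_simp

end Contour

/-! ### Bounded resolvents and Riesz projectors. -/

section Resolvent

open scoped NNReal
open Metric

variable {R A : Type*} [CommSemiring R] [Ring A] [Algebra R A]

lemma resolvent_mul_cancel {a : A} {z : R} (hz : z ∈ resolventSet R a) :
    resolvent a z * (algebraMap R A z - a) = 1 :=
  Ring.inverse_mul_cancel _ hz

lemma mul_resolvent_cancel {a : A} {z : R} (hz : z ∈ resolventSet R a) :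
    (algebraMap R A z - a) * resolvent a z = 1 :=
  Ring.mul_inverse_cancel _ hz

lemma mem_resolventSet_of_mul_eq_one {a b : A} {z : R} (h1 : (algebraMap R A z - a) * b = 1)
    (h2 : b * (algebraMap R A z - a) = 1) : z ∈ resolventSet R a :=
  ⟨⟨_, b, h1, h2⟩, rfl⟩

variable {V : Type*} [NormedAddCommGroup V] [NormedSpace ℂ V]

lemma resolvent_apply_eq_of_sub_eq {X : V →L[ℂ] V} {z : ℂ} (hz : z ∈ resolventSet ℂ X) {u v : V}
    (h : z • u - X u = v) : resolvent X z v = u := by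
  have := DFunLike.congr_fun (resolvent_mul_cancel hz) u
  simpa [Algebra.algebraMap_eq_smul_one, h] using this

lemma sub_resolvent_apply {X : V →L[ℂ] V} {z : ℂ} (hz : z ∈ resolventSet ℂ X) (v : V) :
    z • resolvent X z v - X (resolvent X z v) = v := by
  have := DFunLike.congr_fun (mul_resolvent_cancel hz) v
  simpa [Algebra.algebraMap_eq_smul_one] using this

variable [CompleteSpace V] {Θ : ℝ → ℂ} {K : ℝ≥0}

lemma continuousOn_resolvent_comp {B : Type*} [NormedRing B] [NormedAlgebra ℂ B] [CompleteSpace B]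
    {a : B} (hΘ : LipschitzOnWith K Θ (Icc 0 1))
    (h : ∀ t ∈ Icc (0 : ℝ) 1, Θ t ∈ resolventSet ℂ a) :
    ContinuousOn (fun t => resolvent a (Θ t)) (Icc 0 1) := fun t ht =>
  ((spectrum.hasDerivAt_resolvent_const_left (h t ht)).continuousAt).comp_continuousWithinAt
    (hΘ.continuousOn t ht)

/-- Since `R(z) v = (z - ν)⁻¹ (v + R(z) (X - ν) v)`, one power of `X - ν` is traded for one more
factor `(z - ν)⁻¹`. The exponent `j` is general so that the induction can absorb these factors; only
the simple pole contributes. -/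
lemma contourIntegral_pow_smul_resolvent_apply (hΘ : LipschitzOnWith K Θ (Icc 0 1))
    (hclosed : Θ 0 = Θ 1) {X : V →L[ℂ] V} (hX : ∀ t ∈ Icc (0 : ℝ) 1, Θ t ∈ resolventSet ℂ X)
    {ν : ℂ} (hν : ∀ t ∈ Icc (0 : ℝ) 1, Θ t ≠ ν) (n : ℕ) :
    ∀ v : V, ((X - ν • (1 : V →L[ℂ] V)) ^ n) v = 0 → ∀ j : ℕ,
      contourIntegral Θ (fun z => ((z - ν)⁻¹) ^ j • resolvent X z v) =
        if j = 0 then (2 * Real.pi * Complex.I * windingNumber Θ ν) • v else 0 := by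
  induction n with
  | zero =>
    intro v hv j
    have hv : v = 0 := by simpa using hv
    simp [hv, contourIntegral]
  | succ n ih =>
    intro v hv j
    have hy : ((X - ν • (1 : V →L[ℂ] V)) ^ n) (X v - ν • v) = 0 := by
      rw [pow_succ] at hv
      simpa using hv
    have hc : ∀ i : ℕ, ContinuousOn (fun t => ((Θ t - ν)⁻¹) ^ i) (Icc 0 1) := fun i =>
      ((hΘ.continuousOn.sub continuousOn_const).inv₀ fun t ht => sub_ne_zero.2 (hν t ht)).pow i
    have hr : ∀ u : V, ContinuousOn (fun t => resolvent X (Θ t) u) (Icc 0 1) := fun u =>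
      (continuousOn_resolvent_comp hΘ hX).clm_apply continuousOn_const
    have key : contourIntegral Θ (fun z => ((z - ν)⁻¹) ^ j • resolvent X z v) =
        contourIntegral Θ (fun z => ((z - ν)⁻¹) ^ (j + 1) • v +
          ((z - ν)⁻¹) ^ (j + 1) • resolvent X z (X v - ν • v)) := by
      refine contourIntegral_congr fun t ht => ?_
      have h0 : Θ t - ν ≠ 0 := sub_ne_zero.2 (hν t ht)
      have h1 : resolvent X (Θ t) (X v - ν • v) = (Θ t - ν) • resolvent X (Θ t) v - v := by
        have h2 : resolvent X (Θ t) (Θ t • v - X v) = v :=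
          resolvent_apply_eq_of_sub_eq (hX t ht) rfl
        have h3 : X v - ν • v = (Θ t - ν) • v - (Θ t • v - X v) := by
          rw [sub_smul]; abel
        rw [h3, map_sub, h2, map_smul]
      rw [h1, smul_sub, add_sub_cancel, smul_smul, pow_succ, mul_assoc, inv_mul_cancel₀ h0, mul_one]
    rw [key, contourIntegral_add hΘ ((hc _).smul continuousOn_const) ((hc _).smul (hr _)),
      ih _ hy, if_neg (Nat.succ_ne_zero j), add_zero, contourIntegral_smul_const]
    rcases j with _ | j
    · simp only [zero_add, pow_one, if_true]
      rw [contourIntegral_inv_sub]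
    · rw [contourIntegral_inv_sub_pow hΘ hclosed hν, zero_smul, if_neg (Nat.succ_ne_zero j)]

/-- On generalized eigenvectors the spectral projector acts as multiplication by the winding
number about the eigenvalue. -/
lemma spectralProjector_apply_of_pow_apply_eq_zero (hΘ : LipschitzOnWith K Θ (Icc 0 1))
    (hclosed : Θ 0 = Θ 1) {X : V →L[ℂ] V} (hX : ∀ t ∈ Icc (0 : ℝ) 1, Θ t ∈ resolventSet ℂ X)
    {ν : ℂ} (hν : ∀ t ∈ Icc (0 : ℝ) 1, Θ t ≠ ν) {n : ℕ} {v : V}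
    (hv : ((X - ν • (1 : V →L[ℂ] V)) ^ n) v = 0) :
    spectralProjector Θ X v = windingNumber Θ ν • v := by
  have h := contourIntegral_pow_smul_resolvent_apply hΘ hclosed hX hν n v hv 0
  simp only [pow_zero, one_smul, if_true] at h
  have hm := map_contourIntegral hΘ (ContinuousLinearMap.apply ℂ V v)
    (continuousOn_resolvent_comp hΘ hX)
  simp only [ContinuousLinearMap.apply_apply] at hm
  rw [spectralProjector, smul_apply, hm, h, smul_smul,
    inv_mul_cancel_left₀ Complex.two_pi_I_ne_zero]

/-! ### Contours outside a disc containing the spectrum. -/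

section Exterior

variable {B : Type*} [NormedRing B] [NormedAlgebra ℂ B] [CompleteSpace B]

lemma isUnit_one_sub_smul_of_spectrum_subset {B : Type*} [NormedRing B] [NormedAlgebra ℂ B]
    {a : B} {ρ : ℝ} (ha : spectrum ℂ a ⊆ closedBall 0 ρ) {w : ℂ} (hw : ‖w‖ * ρ < 1) : IsUnit (1 - w • a) := by
  rcases eq_or_ne w 0 with rfl | hw0
  · simp
  · have hmem : w⁻¹ ∈ resolventSet ℂ a := by
      by_contra hcon
      have := ha hcon
      rw [mem_closedBall_zero_iff, norm_inv] at this
      have hpos : 0 < ‖w‖ := norm_pos_iff.2 hw0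
      have h2 := mul_le_mul_of_nonneg_left this hpos.le
      rw [mul_inv_cancel₀ hpos.ne'] at h2
      linarith
    have h := (IsUnit.mk0 w hw0).map (algebraMap ℂ B)
    have h2 := h.mul hmem
    rw [mul_sub, ← map_mul, mul_inv_cancel₀ hw0, map_one, ← Algebra.smul_def] at h2
    exact h2

/-- The resolvent has zero integral along a closed curve outside a disc that contains the spectrum,
if the curve does not wind about the disc. -/
lemma contourIntegral_resolvent_eq_zero (hΘ : LipschitzOnWith K Θ (Icc 0 1))
    (hclosed : Θ 0 = Θ 1) {a : B} {ρ : ℝ} (hρ : 0 ≤ ρ) (ha : spectrum ℂ a ⊆ closedBall 0 ρ)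
    (hout : ∀ t ∈ Icc (0 : ℝ) 1, ρ < ‖Θ t‖) (hw : windingNumber Θ 0 = 0) :
    contourIntegral Θ (resolvent a) = 0 := by
  -- Compactness leaves room for a radius `ρ'` strictly between the disc and the curve.
  obtain ⟨t₀, ht₀, hmin⟩ := isCompact_Icc.exists_isMinOn (nonempty_Icc.2 (zero_le_one' ℝ))
    hΘ.continuousOn.norm
  obtain ⟨ρ', hρ', hρ'lt⟩ := exists_between (hout t₀ ht₀)
  have hpos : 0 < ρ' := hρ.trans_lt hρ'
  have hout' : ∀ t ∈ Icc (0 : ℝ) 1, ρ' < ‖Θ t‖ := fun t ht => hρ'lt.trans_le (hmin ht)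
  have hunit : ∀ w ∈ ball (0 : ℂ) ρ'⁻¹, IsUnit (1 - w • a) := fun w hw => by
    refine isUnit_one_sub_smul_of_spectrum_subset ha ?_
    rw [mem_ball_zero_iff] at hw
    calc ‖w‖ * ρ ≤ ρ'⁻¹ * ρ := by gcongr
      _ < ρ'⁻¹ * ρ' := by gcongr
      _ = 1 := inv_mul_cancel₀ hpos.ne'
  -- In the variable `w = z⁻¹` the exterior becomes a disc, where holomorphic functions have
  -- primitives. The resolvent is `z⁻¹ + z⁻² g(z⁻¹)` with this `g`: the first term gives the winding
  -- number, the second has primitive `-G(z⁻¹)`.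
  have hdiff : DifferentiableOn ℂ (fun w : ℂ => Ring.inverse (1 - w • a) * a) (ball 0 ρ'⁻¹) := by
    intro w hw
    have h1 : DifferentiableAt ℂ Ring.inverse (1 - w • a) :=
      (hasFDerivAt_ringInverse (𝕜 := ℂ) (hunit w hw).unit).differentiableAt
    have h2 : DifferentiableAt ℂ (fun w : ℂ => 1 - w • a) w := by fun_prop
    exact ((DifferentiableAt.comp w h1 h2).mul_const a).differentiableWithinAt
  obtain ⟨G, hG⟩ := hdiff.isExactOn_ball
  have hU : IsOpen {z : ℂ | ρ' < ‖z‖} := isOpen_lt continuous_const continuous_norm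
  have hne : ∀ z : ℂ, ρ' < ‖z‖ → z ≠ 0 := fun z hz => norm_pos_iff.1 (hpos.trans hz)
  have hinv : ∀ z : ℂ, ρ' < ‖z‖ → z⁻¹ ∈ ball (0 : ℂ) ρ'⁻¹ := fun z hz => by
    rw [mem_ball_zero_iff, norm_inv]
    exact (inv_lt_inv₀ (hpos.trans hz) hpos).2 hz
  have hres : ∀ z : ℂ, ρ' < ‖z‖ → resolvent a z =
      (z - 0)⁻¹ • (1 : B) + (z⁻¹ ^ 2) • (Ring.inverse (1 - z⁻¹ • a) * a) := fun z hz => by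
    have h1 : Ring.inverse (1 - z⁻¹ • a) * (1 - z⁻¹ • a) = 1 :=
      Ring.inverse_mul_cancel _ (hunit _ (hinv z hz))
    have hmem : z ∈ resolventSet ℂ a := by
      by_contra hcon
      have := ha hcon
      rw [mem_closedBall_zero_iff] at this
      linarith
    have h2 : algebraMap ℂ B z - a = z • (1 - z⁻¹ • a) := by
      rw [smul_sub, smul_inv_smul₀ (hne z hz), Algebra.algebraMap_eq_smul_one]
    have h3 := mul_resolvent_cancel hmem
    rw [h2] at h3
    have h4 : resolvent a z = z⁻¹ • Ring.inverse (1 - z⁻¹ • a) := by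
      calc resolvent a z = (Ring.inverse (1 - z⁻¹ • a) * (1 - z⁻¹ • a)) * resolvent a z := by
            rw [h1, one_mul]
        _ = z⁻¹ • (Ring.inverse (1 - z⁻¹ • a) * (z • (1 - z⁻¹ • a) * resolvent a z)) := by
            rw [smul_mul_assoc, mul_smul_comm, inv_smul_smul₀ (hne z hz), mul_assoc]
        _ = _ := by rw [h3, mul_one]
    have h5 : Ring.inverse (1 - z⁻¹ • a) = 1 + z⁻¹ • (Ring.inverse (1 - z⁻¹ • a) * a) := by
      rw [mul_sub, mul_one, mul_smul_comm] at h1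
      exact eq_add_of_sub_eq h1
    rw [h4, sub_zero, pow_two, ← smul_smul, ← smul_add, ← h5]
  have hΘ0 : ∀ t ∈ Icc (0 : ℝ) 1, Θ t ≠ 0 := fun t ht => hne _ (hout' t ht)
  rw [contourIntegral_congr (g := fun z => (z - 0)⁻¹ • (1 : B) +
    (z⁻¹ ^ 2) • (Ring.inverse (1 - z⁻¹ • a) * a)) fun t ht => hres _ (hout' t ht),
    contourIntegral_add hΘ, contourIntegral_smul_const, contourIntegral_inv_sub, hw, mul_zero,
    zero_smul, zero_add]
  · refine contourIntegral_eq_zero_of_hasDerivAt hΘ hclosed hU hout' (G := fun z => -G z⁻¹)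
      fun z hz => ?_
    have := ((hG _ (hinv z hz)).scomp z (hasDerivAt_inv (hne z hz))).neg
    refine this.congr_deriv ?_
    rw [neg_smul, neg_neg, inv_pow]
  · exact ((hΘ.continuousOn.sub continuousOn_const).inv₀ fun t ht => by
      simpa using hΘ0 t ht).smul continuousOn_const
  · have h1 : ContinuousOn (fun t => (Θ t)⁻¹) (Icc 0 1) := hΘ.continuousOn.inv₀ hΘ0
    exact (h1.pow 2).smul (hdiff.continuousOn.comp h1 fun t ht => hinv _ (hout' t ht))

end Exterior

/-! ### Removing isolated spectral points by an intertwining injection. -/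

section Isolated

lemma map_circleIntegral {B B' : Type*} [NormedAddCommGroup B] [NormedSpace ℂ B] [CompleteSpace B]
    [NormedAddCommGroup B'] [NormedSpace ℂ B'] [CompleteSpace B'] (φ : B →L[ℂ] B') {f : ℂ → B}
    {c : ℂ} {r : ℝ} (hf : CircleIntegrable f c r) :
    φ (circleIntegral f c r) = circleIntegral (fun z => φ (f z)) c r := by
  simp only [circleIntegral, ← φ.map_smul]
  exact (φ.intervalIntegral_comp_comm hf.out).symm

variable {H : Type*} [NormedAddCommGroup H] [NormedSpace ℂ H] [CompleteSpace H]

/-- If a continuous injection `j` intertwines `a` and `b`, then an isolated point of the spectrum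
of `a` belongs to the spectrum of `b`. -/
lemma mem_resolventSet_of_intertwining {a : V →L[ℂ] V} {b : H →L[ℂ] H} {j : V →L[ℂ] H}
    (hj : Function.Injective j) (hab : ∀ v, j (a v) = b (j v)) {μ : ℂ} {ε : ℝ} (hε : 0 < ε)
    (ha : ∀ z ∈ ball μ ε, z ≠ μ → z ∈ resolventSet ℂ a)
    (hb : ∀ z ∈ ball μ ε, z ∈ resolventSet ℂ b) : μ ∈ resolventSet ℂ a := by
  set r := ε / 2 with hr
  have hr0 : 0 < r := by positivity
  have hsub : closedBall μ r ⊆ ball μ ε := closedBall_subset_ball (by linarith)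
  have hsph : ∀ z ∈ sphere μ r, z ∈ resolventSet ℂ a ∧ z - μ ≠ 0 := fun z hz => by
    have hne : z ≠ μ := ne_of_mem_sphere hz hr0.ne'
    exact ⟨ha z (hsub (sphere_subset_closedBall hz)) hne, sub_ne_zero.2 hne⟩
  have hcont : ContinuousOn (resolvent a) (sphere μ r) := fun z hz =>
    (spectrum.hasDerivAt_resolvent_const_left (hsph z hz).1).continuousAt.continuousWithinAt
  have hcinv : ContinuousOn (fun z : ℂ => (z - μ)⁻¹) (sphere μ r) :=
    (continuousOn_id.sub continuousOn_const).inv₀ fun z hz => (hsph z hz).2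
  -- The residue of the resolvent at `μ` vanishes: `j` maps it to an integral of the resolvent of
  -- `b`, which is holomorphic on the disc.
  have hP : (∮ z in C(μ, r), resolvent a z) = 0 := by
    ext v
    apply hj
    have h1 := map_circleIntegral (j.comp (ContinuousLinearMap.apply ℂ V v))
      (hcont.circleIntegrable hr0.le)
    simp only [ContinuousLinearMap.comp_apply, ContinuousLinearMap.apply_apply] at h1
    rw [h1, zero_apply, map_zero]
    have h2 : EqOn (fun z => j (resolvent a z v)) (fun z => resolvent b z (j v)) (sphere μ r) :=
      fun z hz => by
        have hz' := hsph z hz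
        refine (resolvent_apply_eq_of_sub_eq (hb z (hsub (sphere_subset_closedBall hz))) ?_).symm
        rw [← hab, ← map_smul, ← map_sub, sub_resolvent_apply hz'.1]
    rw [circleIntegral.integral_congr hr0.le h2]
    have hd : ∀ z ∈ ball μ ε, DifferentiableAt ℂ (fun z => resolvent b z (j v)) z := fun z hz =>
      (spectrum.hasDerivAt_resolvent_const_left (hb z hz)).differentiableAt.clm_apply
        (differentiableAt_const _)
    exact Complex.circleIntegral_eq_zero_of_differentiable_on_off_countable hr0.le
      countable_empty (fun z hz => (hd z (hsub hz)).continuousAt.continuousWithinAt)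
      fun z hz => hd z (hsub (ball_subset_closedBall hz.1))
  have hint : CircleIntegrable (fun z => (z - μ)⁻¹ • resolvent a z) μ r :=
    (hcinv.smul hcont).circleIntegrable hr0.le
  have hint1 : CircleIntegrable (fun z => (z - μ)⁻¹ • (1 : V →L[ℂ] V)) μ r :=
    (hcinv.smul continuousOn_const).circleIntegrable hr0.le
  have hone : (∮ z in C(μ, r), ((z - μ)⁻¹ • (1 : V →L[ℂ] V) - resolvent a z)) =
      (2 * Real.pi * Complex.I) • (1 : V →L[ℂ] V) := by
    rw [circleIntegral.integral_sub hint1 (hcont.circleIntegrable hr0.le), hP, sub_zero,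
      circleIntegral.integral_smul_const, circleIntegral.integral_sub_center_inv _ hr0.ne']
  have hsplit : ∀ z : ℂ, algebraMap ℂ (V →L[ℂ] V) μ - a =
      (algebraMap ℂ (V →L[ℂ] V) z - a) - (z - μ) • 1 := fun z => by
    rw [sub_smul, Algebra.algebraMap_eq_smul_one, Algebra.algebraMap_eq_smul_one]; abel
  -- The inverse is the constant Laurent coefficient of the resolvent at `μ`. Writing `μ - a = (z -
  -- a) - (z - μ)` turns the product into the integral of `(z - μ)⁻¹ - R(z)`, which is `2πi` because
  -- the residue is zero.
  refine mem_resolventSet_of_mul_eq_one (b := (2 * Real.pi * Complex.I)⁻¹ •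
    ∮ z in C(μ, r), (z - μ)⁻¹ • resolvent a z) ?_ ?_
  · have h1 := map_circleIntegral
      (ContinuousLinearMap.mul ℂ (V →L[ℂ] V) (algebraMap ℂ (V →L[ℂ] V) μ - a)) hint
    simp only [ContinuousLinearMap.mul_apply'] at h1
    rw [mul_smul_comm, h1, circleIntegral.integral_congr hr0.le
      (g := fun z => (z - μ)⁻¹ • (1 : V →L[ℂ] V) - resolvent a z), hone,
      inv_smul_smul₀ Complex.two_pi_I_ne_zero]
    intro z hz
    simp only
    rw [mul_smul_comm, hsplit z, sub_mul, mul_resolvent_cancel (hsph z hz).1, smul_one_mul,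
      smul_sub, inv_smul_smul₀ (hsph z hz).2]
  · have h1 := map_circleIntegral
      ((ContinuousLinearMap.mul ℂ (V →L[ℂ] V)).flip (algebraMap ℂ (V →L[ℂ] V) μ - a)) hint
    simp only [ContinuousLinearMap.flip_apply, ContinuousLinearMap.mul_apply'] at h1
    rw [smul_mul_assoc, h1, circleIntegral.integral_congr hr0.le
      (g := fun z => (z - μ)⁻¹ • (1 : V →L[ℂ] V) - resolvent a z), hone,
      inv_smul_smul₀ Complex.two_pi_I_ne_zero]
    intro z hz
    simp only
    rw [smul_mul_assoc, hsplit z, mul_sub, resolvent_mul_cancel (hsph z hz).1, mul_smul_one,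
      smul_sub, inv_smul_smul₀ (hsph z hz).2]

end Isolated

end Resolvent

/-! ### Resolvents of the unbounded selfadjoint operator. -/

section SelfAdjoint

variable {H : Type*} [NormedAddCommGroup H] [InnerProductSpace ℂ H]

lemma isResolventAt_resolventOf {A : H →ₗ.[ℂ] H} {z : ℂ} (hz : z ∈ resolventSetOf A) :
    IsResolventAt A z (resolventOf A z) := by
  rw [resolventOf, dif_pos (show ∃ R, IsResolventAt A z R from hz)]
  exact Exists.choose_spec (show ∃ R, IsResolventAt A z R from hz)

/-- The first resolvent identity. -/
lemma IsResolventAt.sub_eq {A : H →ₗ.[ℂ] H} {z w : ℂ} {R S : H →L[ℂ] H}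
    (hR : IsResolventAt A z R) (hS : IsResolventAt A w S) : R - S = (w - z) • (R * S) := by
  ext u
  obtain ⟨x, hx, hxu⟩ := hS.1 u
  have h1 := hR.2 x
  have h2 : u = (w - z) • (x : H) + (z • (x : H) - A x) := by
    rw [← hxu, sub_smul]; abel
  have h3 : R u = (w - z) • R x + x := by rw [h2, map_add, map_smul, h1]
  simp [h3, ← hx]

lemma IsResolventAt.commute {A : H →ₗ.[ℂ] H} {z w : ℂ} {R S : H →L[ℂ] H}
    (hR : IsResolventAt A z R) (hS : IsResolventAt A w S) : Commute R S := by
  rcases eq_or_ne z w with rfl | hne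
  · have h := hR.sub_eq hS
    rw [sub_self, zero_smul, sub_eq_zero] at h
    rw [h]
  · have h1 := hR.sub_eq hS
    have h2 := hS.sub_eq hR
    have h3 : (w - z) • (R * S) = (w - z) • (S * R) := by
      rw [← h1, ← neg_sub S R, h2, ← neg_smul, neg_sub]
    exact smul_right_injective _ (sub_ne_zero.2 hne.symm) h3

lemma IsResolventAt.apply_eigenvector {A : H →ₗ.[ℂ] H} {z : ℂ} {R : H →L[ℂ] H}
    (hR : IsResolventAt A z R) {lam : ℝ} (hz : z ≠ lam) {u : H} (hu : u ∈ eigenvectors A lam) :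
    R u = (z - lam)⁻¹ • u := by
  obtain ⟨x, rfl, hx⟩ := hu
  have h := hR.2 x
  rw [hx, ← sub_smul, map_smul] at h
  rw [eq_inv_smul_iff₀ (sub_ne_zero.2 hz), h]

lemma IsResolventAt.mem_eigenvectors {A : H →ₗ.[ℂ] H} {z : ℂ} {R : H →L[ℂ] H}
    (hR : IsResolventAt A z R) {lam : ℝ} (hz : z ≠ lam) {u : H} (hu : R u = (z - lam)⁻¹ • u) :
    u ∈ eigenvectors A lam := by
  have hne := sub_ne_zero.2 hz
  obtain ⟨x, hx, hxu⟩ := hR.1 u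
  rw [hu, eq_inv_smul_iff₀ hne] at hx
  refine ⟨(z - lam) • x, hx, ?_⟩
  have h : A x = (lam : ℂ) • (x : H) := by
    have h1 : A x = z • (x : H) - u := by rw [← hxu]; abel
    rw [h1, ← hx, sub_smul]; abel
  rw [LinearPMap.map_smul, h, Submodule.coe_smul, smul_comm]

lemma mem_spectrumOf_of_eigenvector {A : H →ₗ.[ℂ] H} {lam : ℝ} {u : H}
    (hu : u ∈ eigenvectors A lam) (hu0 : u ≠ 0) : (lam : ℂ) ∈ spectrumOf A := by
  rintro ⟨R, hR⟩
  obtain ⟨x, rfl, hx⟩ := hu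
  have h := hR.2 x
  rw [hx, sub_self, map_zero] at h
  exact hu0 h.symm

/-- If `R` were the resolvent at `z - t⁻¹`, then `t⁻¹ (1 + t⁻¹ R)` would invert `t - T`. This
carries spectral information from `A` to the bounded operator `T`. -/
lemma sub_inv_mem_spectrumOf {A : H →ₗ.[ℂ] H} {z : ℂ} {T : H →L[ℂ] H} (hT : IsResolventAt A z T)
    {t : ℂ} (ht : t ∈ spectrum ℂ T) (ht0 : t ≠ 0) : z - t⁻¹ ∈ spectrumOf A := by
  rintro ⟨R, hR⟩
  have h' : T * R = R * T := hT.commute hR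
  have h : t⁻¹ • R = t⁻¹ • T + t⁻¹ • t⁻¹ • (R * T) := by
    have h2 : R - T = t⁻¹ • (R * T) := by
      rw [← neg_sub, hT.sub_eq hR, ← neg_smul, h']
      congr 1
      ring
    rw [← smul_add, ← h2, add_sub_cancel]
  refine ht (mem_resolventSet_of_mul_eq_one (b := t⁻¹ • (1 + t⁻¹ • R)) ?_ ?_)
  · rw [Algebra.algebraMap_eq_smul_one, sub_mul, mul_smul_comm, smul_one_mul, inv_smul_smul₀ ht0,
      mul_smul_comm, mul_add, mul_one, mul_smul_comm, h', smul_add, h, add_sub_cancel_right]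
  · rw [Algebra.algebraMap_eq_smul_one, mul_sub, mul_smul_comm, smul_mul_assoc, mul_one,
      smul_inv_smul₀ ht0, smul_mul_assoc, add_mul, one_mul, smul_mul_assoc, smul_add, h,
      add_sub_cancel_right]

variable [CompleteSpace H]

/-- The relation `⟨R* u, (z - A) x⟩ = ⟨u, x⟩` puts `R* u` into the domain of the adjoint of `A`,
which is `A` itself. Resolvents commute, so normality of `R` follows. -/
lemma IsResolventAt.adjoint {A : H →ₗ.[ℂ] H} (hA : IsSelfAdjoint A) {z : ℂ} {R : H →L[ℂ] H}
    (hR : IsResolventAt A z R) : IsResolventAt A (starRingEnd ℂ z) (ContinuousLinearMap.adjoint R) := by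
  have hAdj : A.adjoint = A := LinearPMap.isSelfAdjoint_def.1 hA
  have hdense := hA.dense_domain
  have hsymm : ∀ x y : A.domain, inner ℂ (A x) (y : H) = inner ℂ (x : H) (A y) := by
    have h := LinearPMap.adjoint_isFormalAdjoint (T := A) hdense
    rw [hAdj] at h
    exact fun x y => h x y
  refine ⟨fun u => ?_, fun x => ?_⟩
  · set y := ContinuousLinearMap.adjoint R u with hy
    have hkey : ∀ x : A.domain, inner ℂ (starRingEnd ℂ z • y - u) (x : H) = inner ℂ y (A x) := by
      intro x
      have h1 : inner ℂ y (z • (x : H) - A x) = inner ℂ u (x : H) := by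
        rw [hy, ContinuousLinearMap.adjoint_inner_left, hR.2 x]
      rw [inner_sub_right, inner_smul_right] at h1
      rw [inner_sub_left, inner_smul_left, Complex.conj_conj, ← h1]
      ring
    have hmem : y ∈ A.adjoint.domain := LinearPMap.mem_adjoint_domain_of_exists y ⟨_, hkey⟩
    have hval : A.adjoint ⟨y, hmem⟩ = starRingEnd ℂ z • y - u :=
      LinearPMap.adjoint_apply_eq hdense _ hkey
    have hmem' : y ∈ A.domain := hAdj ▸ hmem
    refine ⟨⟨y, hmem'⟩, rfl, ?_⟩
    have hval' : A ⟨y, hmem'⟩ = starRingEnd ℂ z • y - u := by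
      rw [← hval]
      exact @(LinearPMap.ext_iff.1 hAdj.symm).2 y hmem' hmem
    rw [hval']
    simp
  · refine ext_inner_right ℂ fun u => ?_
    rw [ContinuousLinearMap.adjoint_inner_left]
    obtain ⟨v, hv, hvu⟩ := hR.1 u
    rw [← hv]
    rw [← hvu, inner_sub_left, inner_sub_right, inner_smul_left, inner_smul_right, Complex.conj_conj,
      hsymm]

lemma IsResolventAt.isStarNormal {A : H →ₗ.[ℂ] H} (hA : IsSelfAdjoint A) {z : ℂ} {R : H →L[ℂ] H}
    (hR : IsResolventAt A z R) : IsStarNormal R :=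
  ⟨(hR.adjoint hA).commute hR⟩

end SelfAdjoint

/-! ### The scalar filter on the real line. -/

section Filter

variable {N : ℕ} (F : RationalFilter N)

lemma RationalFilter.tendsto_r_atTop :
    Tendsto (fun x : ℝ => F.r (x : ℂ)) atTop (𝓝 (F.w (Fin.last N))) := by
  have h : ∀ k : Fin N, Tendsto (fun x : ℝ => F.w k.castSucc * (F.z k - (x : ℂ))⁻¹) atTop
      (𝓝 0) := fun k => by
    have h1 : Tendsto (fun x : ℝ => F.z k - (x : ℂ)) atTop (Bornology.cobounded ℂ) := by
      rw [← tendsto_norm_atTop_iff_cobounded]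
      refine tendsto_atTop_mono (f := fun x : ℝ => x - ‖F.z k‖) (fun x => ?_)
        (tendsto_atTop_add_const_right _ _ tendsto_id)
      have h2 := norm_sub_norm_le (x : ℂ) (F.z k)
      rw [norm_sub_rev, Complex.norm_real] at h2
      exact (sub_le_sub_right (le_abs_self x) _).trans h2
    simpa using (tendsto_inv₀_cobounded.comp h1).const_mul (F.w k.castSucc)
  simpa [RationalFilter.r] using (tendsto_finsetSum Finset.univ fun k _ => h k).const_add
    (F.w (Fin.last N))

lemma RationalFilter.enorm_r_le_supOuter {y γ δ x : ℝ} (hx : (1 + δ) * γ ≤ |x - y|)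
    (hz : ∀ k, F.z k ≠ (x : ℂ)) : ‖F.r (x : ℂ)‖ₑ ≤ F.supOuter y γ δ :=
  le_iSup₂ (f := fun (x : ℝ)
    (_ : x ∈ {x : ℝ | (1 + δ) * γ ≤ |x - y| ∧ ∀ k, F.z k ≠ (x : ℂ)}) => ‖F.r (x : ℂ)‖ₑ) x ⟨hx, hz⟩

lemma RationalFilter.infInner_le_enorm_r {y γ x : ℝ} (hx : |x - y| ≤ γ)
    (hz : ∀ k, F.z k ≠ (x : ℂ)) : F.infInner y γ ≤ ‖F.r (x : ℂ)‖ₑ :=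
  iInf₂_le (f := fun (x : ℝ)
    (_ : x ∈ {x : ℝ | |x - y| ≤ γ ∧ ∀ k, F.z k ≠ (x : ℂ)}) => ‖F.r (x : ℂ)‖ₑ) x ⟨hx, hz⟩

/-- `w_N` is the value of `r_N` at infinity, a limit of values on the outer set. It is needed
because `0` may belong to the spectrum of a resolvent of `A`. -/
lemma RationalFilter.enorm_w_last_le_supOuter (y γ δ : ℝ) :
    ‖F.w (Fin.last N)‖ₑ ≤ F.supOuter y γ δ := by
  refine le_of_tendsto (F.tendsto_r_atTop.enorm) ?_
  have h1 : ∀ᶠ x : ℝ in atTop, (1 + δ) * γ ≤ |x - y| := by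
    filter_upwards [eventually_ge_atTop (y + (1 + δ) * γ)] with x hx
    exact le_trans (by linarith) (le_abs_self _)
  have h2 : ∀ᶠ x : ℝ in atTop, ∀ k, F.z k ≠ (x : ℂ) := by
    rw [eventually_all]
    intro k
    filter_upwards [eventually_gt_atTop (F.z k).re] with x hx h
    rw [h] at hx
    simp at hx
  filter_upwards [h1, h2] with x hx1 hx2
  exact F.enorm_r_le_supOuter hx1 hx2

lemma RationalFilter.supOuter_lt_infInner {y γ δ : ℝ} (h0 : F.infInner y γ ≠ 0)
    (hκ : F.kappaHat y γ δ < 1) (htop : F.infInner y γ ≠ ⊤) :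
    F.supOuter y γ δ < F.infInner y γ := by
  rw [RationalFilter.kappaHat, ENNReal.div_lt_iff (Or.inl h0) (Or.inl htop), one_mul] at hκ
  exact hκ

end Filter

/-! ### Separation of the cluster from the remaining spectrum. -/

section Separation

variable {H : Type*} [NormedAddCommGroup H] [InnerProductSpace ℂ H]

lemma IsEigenvalueCluster.mem_spectrumOf {A : H →ₗ.[ℂ] H} {Λ : Finset ℝ}
    (hΛ : IsEigenvalueCluster A Λ) {lam : ℝ} (h : lam ∈ Λ) : (lam : ℂ) ∈ spectrumOf A :=
  let ⟨_, hu, hu0⟩ := hΛ.eigenvalue lam h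
  mem_spectrumOf_of_eigenvector hu hu0

lemma SeparatesSpectrum.node_ne {A : H →ₗ.[ℂ] H} {Λ : Finset ℝ} {N : ℕ} {F : RationalFilter N}
    (hF : SeparatesSpectrum A Λ F) (k : Fin N) {ξ : ℂ} (hξ : ξ ∈ spectrumOf A) : F.z k ≠ ξ :=
  fun h => hF.2 k (h ▸ subset_closure hξ)

lemma SeparatesSpectrum.isResolventAt {A : H →ₗ.[ℂ] H} {Λ : Finset ℝ} {N : ℕ}
    {F : RationalFilter N} (hF : SeparatesSpectrum A Λ F) (k : Fin N) :
    IsResolventAt A (F.z k) (resolventOf A (F.z k)) :=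
  isResolventAt_resolventOf (by_contra fun h => hF.node_ne k h rfl)

/-- The real number `s` separates the moduli of `r_N` on the cluster from those on the rest of the
spectrum and at infinity. -/
lemma SeparatesSpectrum.exists_bound {A : H →ₗ.[ℂ] H} {Λ : Finset ℝ} (hΛ : IsEigenvalueCluster A Λ)
    {N : ℕ} {F : RationalFilter N} (hF : SeparatesSpectrum A Λ F) :
    ∃ s : ℝ, ‖F.w (Fin.last N)‖ ≤ s ∧
      (∀ ξ ∈ spectrumOf A, (∀ lam ∈ Λ, ξ ≠ (lam : ℂ)) → ‖F.r ξ‖ ≤ s) ∧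
      ∀ lam ∈ Λ, s < ‖F.r (lam : ℂ)‖ := by
  obtain ⟨⟨y, γ, δ, hγ, hδ, hI, hO, h0, hκ⟩, hz⟩ := hF
  have hF : SeparatesSpectrum A Λ F := ⟨⟨y, γ, δ, hγ, hδ, hI, hO, h0, hκ⟩, hz⟩
  have hinf : ∀ lam ∈ Λ, F.infInner y γ ≤ ‖F.r (lam : ℂ)‖ₑ := fun lam h =>
    F.infInner_le_enorm_r (hI lam h) fun k => hF.node_ne k (hΛ.mem_spectrumOf h)
  obtain ⟨lam₀, h₀⟩ := hΛ.nonempty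
  -- A quotient by `⊤` is zero in `ENNReal` and would carry no information; a cluster point, which
  -- is not a node, excludes this.
  have htop : F.infInner y γ ≠ ⊤ := ne_top_of_le_ne_top enorm_ne_top (hinf lam₀ h₀)
  have hlt := F.supOuter_lt_infInner h0 hκ htop
  have hfin : F.supOuter y γ δ ≠ ⊤ := hlt.ne_top
  refine ⟨(F.supOuter y γ δ).toReal, ?_, fun ξ hξ hne => ?_, fun lam h => ?_⟩
  · rw [← toReal_enorm]
    exact ENNReal.toReal_mono hfin (F.enorm_w_last_le_supOuter y γ δ)
  · obtain ⟨x, rfl, hx⟩ := hO ξ hξ hne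
    rw [← toReal_enorm]
    exact ENNReal.toReal_mono hfin (F.enorm_r_le_supOuter hx fun k => hF.node_ne k hξ)
  · rw [← toReal_enorm]
    exact (ENNReal.toReal_lt_toReal hfin enorm_ne_top).2 (hlt.trans_le (hinf lam h))

/-- Without nodes `r_N` is constant and separates nothing. A node is needed as base point for the
functional calculus. -/
lemma SeparatesSpectrum.node_nonempty {A : H →ₗ.[ℂ] H} {Λ : Finset ℝ}
    (hΛ : IsEigenvalueCluster A Λ) {N : ℕ} {F : RationalFilter N} (hF : SeparatesSpectrum A Λ F) :
    Nonempty (Fin N) := by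
  by_contra hN
  rw [not_nonempty_iff] at hN
  obtain ⟨s, h1, -, h2⟩ := hF.exists_bound hΛ
  obtain ⟨lam, h⟩ := hΛ.nonempty
  have h3 := h2 lam h
  simp only [RationalFilter.r, Finset.univ_eq_empty, Finset.sum_empty, add_zero] at h3
  linarith

lemma SeparatesSpectrum.eventually_eq {A : H →ₗ.[ℂ] H} {Λ : Finset ℝ} {N : ℕ}
    {F : RationalFilter N} (hF : SeparatesSpectrum A Λ F) {lam : ℝ} (h : lam ∈ Λ) :
    ∀ᶠ ξ : ℂ in 𝓝 (lam : ℂ), ξ ∈ spectrumOf A → ξ = lam := by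
  obtain ⟨⟨y, γ, δ, hγ, hδ, hI, hO, -, -⟩, -⟩ := hF
  have h1 : ∀ᶠ ξ : ℂ in 𝓝 (lam : ℂ), ‖ξ - y‖ < (1 + δ) * γ := by
    refine (isOpen_lt (by fun_prop) continuous_const).mem_nhds ?_
    have h2 : ‖(lam : ℂ) - y‖ ≤ γ := by
      rw [← Complex.ofReal_sub, Complex.norm_real]
      exact hI lam h
    exact lt_of_le_of_lt h2 (by nlinarith)
  have h2 : ∀ᶠ ξ : ℂ in 𝓝 (lam : ℂ), ∀ lam' ∈ Λ.erase lam, ξ ≠ lam' := by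
    rw [eventually_all_finset]
    intro lam' h'
    refine isOpen_ne.mem_nhds ?_
    exact fun he => Finset.ne_of_mem_erase h' (Complex.ofReal_injective he).symm
  filter_upwards [h1, h2] with ξ hξ1 hξ2 hξ
  by_contra hne
  obtain ⟨x, rfl, hx⟩ := hO ξ hξ fun lam' h' => by
    rcases eq_or_ne lam' lam with rfl | h3
    · exact hne
    · exact hξ2 lam' (Finset.mem_erase.2 ⟨h3, h'⟩)
  rw [← Complex.ofReal_sub, Complex.norm_real] at hξ1
  exact absurd hx (not_le.2 hξ1)

end Separation

/-! ### The spectral projection in `H` by continuous functional calculus. -/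

section Projection

variable {H : Type*} [NormedAddCommGroup H] [InnerProductSpace ℂ H] [CompleteSpace H]

/-- The resolvent identity reads `R (1 + (z - z₀) T) = T`, so each resolvent is a function of the
single normal operator `T`. -/
lemma cfc_div_one_add_eq_resolvent {A : H →ₗ.[ℂ] H} {z₀ z : ℂ} {T R : H →L[ℂ] H} [IsStarNormal T]
    (hT : IsResolventAt A z₀ T) (hR : IsResolventAt A z R)
    (hne : ∀ t ∈ spectrum ℂ T, 1 + (z - z₀) * t ≠ 0) :
    cfc (fun t : ℂ => t / (1 + (z - z₀) * t)) T = R := by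
  have hc1 : ContinuousOn (fun t : ℂ => t / (1 + (z - z₀) * t)) (spectrum ℂ T) :=
    continuousOn_id.div (by fun_prop) hne
  have hc2 : ContinuousOn (fun t : ℂ => 1 + (z - z₀) * t) (spectrum ℂ T) := by fun_prop
  have h1 : cfc (fun t : ℂ => 1 + (z - z₀) * t) T = 1 + (z - z₀) • T := by
    rw [cfc_add .., cfc_const_one ℂ T, cfc_const_mul .., cfc_id' ℂ T]
  have h2 : cfc (fun t : ℂ => t / (1 + (z - z₀) * t)) T * (1 + (z - z₀) • T) = T := by
    rw [← h1, ← cfc_mul _ _ _ hc1 hc2]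
    refine (cfc_congr fun t ht => ?_).trans (cfc_id' ℂ T)
    exact div_mul_cancel₀ _ (hne t ht)
  have hTR := hT.sub_eq hR
  have hcomm : T * R = R * T := hT.commute hR
  have h3 : R * (1 + (z - z₀) • T) = T := by
    rw [mul_add, mul_one, mul_smul_comm, ← hcomm, ← hTR, add_sub_cancel]
  have h4 : (1 + (z - z₀) • T) * (1 - (z - z₀) • R) = 1 := by
    have h5 : (z - z₀) • (z - z₀) • (T * R) = (z - z₀) • T - (z - z₀) • R := by
      rw [← hTR, smul_sub]
    rw [mul_sub, mul_one, mul_smul_comm, add_mul, one_mul, smul_mul_assoc, smul_add, h5]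
    abel
  calc _ = cfc (fun t : ℂ => t / (1 + (z - z₀) * t)) T *
        ((1 + (z - z₀) • T) * (1 - (z - z₀) • R)) := by rw [h4, mul_one]
    _ = R * ((1 + (z - z₀) • T) * (1 - (z - z₀) • R)) := by rw [← mul_assoc, h2, ← mul_assoc, h3]
    _ = R := by rw [h4, mul_one]

/-- The spectral projection of a selfadjoint operator onto the eigenspace of a separated cluster,
together with the bound on the filter operator off the cluster. -/
theorem SeparatesSpectrum.exists_projection {A : H →ₗ.[ℂ] H} (hA : IsSelfAdjoint A) {Λ : Finset ℝ}
    (hΛ : IsEigenvalueCluster A Λ) {N : ℕ} {F : RationalFilter N} (hF : SeparatesSpectrum A Λ F) :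
    ∃ Q : H →L[ℂ] H, (∀ u, Q u ∈ exactEigenspace A Λ) ∧ (∀ u ∈ exactEigenspace A Λ, Q u = u) ∧
      (∀ k, Commute (resolventOf A (F.z k)) Q) ∧
      ∀ lam ∈ Λ, ‖F.op (fun k => resolventOf A (F.z k)) * (1 - Q)‖ < ‖F.r (lam : ℂ)‖ := by
  classical
  obtain ⟨k₀⟩ := hF.node_nonempty hΛ
  obtain ⟨s, hs1, hs2, hs3⟩ := hF.exists_bound hΛ
  set z₀ := F.z k₀ with hz₀
  set T := resolventOf A z₀ with hTdef
  have hT : IsResolventAt A z₀ T := hF.isResolventAt k₀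
  have : IsStarNormal T := hT.isStarNormal hA
  have hlamne : ∀ lam ∈ Λ, z₀ ≠ (lam : ℂ) := fun lam h => hF.node_ne k₀ (hΛ.mem_spectrumOf h)
  -- The image of the cluster under `ξ ↦ (z₀ - ξ)⁻¹`, which transports the spectrum of `A` to that
  -- of `T`.
  set τ : ℝ → ℂ := fun lam => (z₀ - lam)⁻¹ with hτ
  have hτ0 : ∀ lam ∈ Λ, τ lam ≠ 0 := fun lam h => inv_ne_zero (sub_ne_zero.2 (hlamne lam h))
  have hspec : ∀ t ∈ spectrum ℂ T, t ≠ 0 → z₀ - t⁻¹ ∈ spectrumOf A := fun t ht h0 =>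
    sub_inv_mem_spectrumOf hT ht h0
  have hτeq : ∀ (t : ℂ) (lam : ℝ), z₀ - t⁻¹ = lam → t = τ lam := fun t lam h => by
    rw [hτ]; simp only; rw [← h, sub_sub_cancel, inv_inv]
  have hiso : ∀ lam ∈ Λ, ∀ᶠ t in 𝓝 (τ lam), t ∈ spectrum ℂ T → t = τ lam := fun lam h => by
    have hcont : Tendsto (fun t : ℂ => z₀ - t⁻¹) (𝓝 (τ lam)) (𝓝 (lam : ℂ)) := by
      have h1 := (continuousAt_inv₀ (hτ0 lam h)).tendsto.const_sub z₀
      have h2 : z₀ - (τ lam)⁻¹ = lam := by simp [hτ]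
      rwa [h2] at h1
    filter_upwards [hcont.eventually (hF.eventually_eq h), isOpen_ne.mem_nhds (hτ0 lam h)]
      with t ht1 ht2 ht
    exact hτeq t lam (ht1 (hspec t ht ht2))
  -- At an isolated point of the spectrum every function is continuous, so indicators are admissible
  -- in the continuous calculus.
  have hisoc : ∀ lam ∈ Λ, ∀ f : ℂ → ℂ, ContinuousWithinAt f (spectrum ℂ T) (τ lam) :=
    fun lam h f => by
      refine tendsto_nhds_of_eventually_eq ?_
      rw [eventually_nhdsWithin_iff]
      filter_upwards [hiso lam h] with t ht htT
      rw [ht htT]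
  set χ : ℝ → ℂ → ℂ := fun lam t => if t = τ lam then 1 else 0 with hχ
  have hχc : ∀ lam ∈ Λ, ContinuousOn (χ lam) (spectrum ℂ T) := fun lam h t ht => by
    rcases eq_or_ne t (τ lam) with rfl | hne
    · exact hisoc lam h _
    · have : χ lam =ᶠ[𝓝 t] fun _ => 0 := by
        filter_upwards [isOpen_ne.mem_nhds hne] with t' ht'
        exact if_neg ht'
      exact (continuousAt_const.congr this.symm).continuousWithinAt
  set X : ℂ → ℂ := fun t => ∑ lam ∈ Λ, χ lam t with hX
  have hXc : ContinuousOn X (spectrum ℂ T) := continuousOn_finsetSum _ hχc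
  have hXone : ∀ lam ∈ Λ, X (τ lam) = 1 := fun lam h => by
    rw [hX]
    simp only
    rw [Finset.sum_eq_single_of_mem lam h]
    · simp [hχ]
    · intro lam' h' hne
      refine if_neg fun he => hne ?_
      have := inv_injective he
      exact Complex.ofReal_injective (sub_right_injective this).symm
  have hXval : cfc X T = ∑ lam ∈ Λ, cfc (χ lam) T := by
    rw [← cfc_sum _ _ _ hχc]
    congr 1
    ext t
    simp [hX]
  have hnode : ∀ k, ∀ t ∈ spectrum ℂ T, 1 + (F.z k - z₀) * t ≠ 0 := fun k t ht h0 => by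
    have ht0 : t ≠ 0 := by rintro rfl; simp at h0
    refine hF.node_ne k (hspec t ht ht0) ?_
    field_simp
    linear_combination h0
  have hRk : ∀ k, cfc (fun t : ℂ => t / (1 + (F.z k - z₀) * t)) T = resolventOf A (F.z k) :=
    fun k => cfc_div_one_add_eq_resolvent hT (hF.isResolventAt k) (hnode k)
  have hgc : ∀ k, ContinuousOn (fun t : ℂ => t / (1 + (F.z k - z₀) * t)) (spectrum ℂ T) :=
    fun k => continuousOn_id.div (by fun_prop) (hnode k)
  set f : ℂ → ℂ := fun t => F.w (Fin.last N) +
    ∑ k : Fin N, F.w k.castSucc * (t / (1 + (F.z k - z₀) * t)) with hf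
  have hgc' : ∀ k, ContinuousOn (fun t : ℂ => F.w (Fin.castSucc k) * (t / (1 + (F.z k - z₀) * t)))
    (spectrum ℂ T) := fun k => continuousOn_const.mul (hgc k)
  have hsumc : ContinuousOn (fun t : ℂ => ∑ k : Fin N, F.w k.castSucc * (t / (1 + (F.z k - z₀) * t)))
    (spectrum ℂ T) := continuousOn_finsetSum _ fun k _ => hgc' k
  have hfc : ContinuousOn f (spectrum ℂ T) := continuousOn_const.add hsumc
  have hfval : cfc f T = F.op (fun k => resolventOf A (F.z k)) := by
    rw [hf, cfc_add _ _ _ continuousOn_const hsumc, cfc_const _ T, RationalFilter.op,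
      Algebra.algebraMap_eq_smul_one]
    congr 1
    have h1 := cfc_sum_univ
      (fun (k : Fin N) (t : ℂ) => F.w k.castSucc * (t / (1 + (F.z k - z₀) * t))) T hgc'
    have h2 : (∑ k : Fin N, fun t : ℂ => F.w k.castSucc * (t / (1 + (F.z k - z₀) * t))) =
        fun t : ℂ => ∑ k : Fin N, F.w k.castSucc * (t / (1 + (F.z k - z₀) * t)) := by
      ext t; simp
    rw [h2] at h1
    rw [h1]
    refine Finset.sum_congr rfl fun k _ => ?_
    rw [cfc_const_mul _ _ _ (hgc k), hRk k]
  have hone : ContinuousOn (fun t : ℂ => 1 - X t) (spectrum ℂ T) := continuousOn_const.sub hXc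
  have hsub : cfc (fun t : ℂ => 1 - X t) T = 1 - cfc X T := by
    rw [cfc_sub _ _ _ continuousOn_const hXc, cfc_const_one ℂ T]
  refine ⟨cfc X T, fun u => ?_, fun u hu => ?_, fun k => ?_, fun lam h => ?_⟩
  · rw [hXval, sum_apply]
    refine Submodule.sum_mem _ fun lam h => Submodule.subset_span (mem_iUnion₂.2 ⟨lam, h, ?_⟩)
    refine hT.mem_eigenvectors (hlamne lam h) ?_
    have h1 : T * cfc (χ lam) T = τ lam • cfc (χ lam) T := by
      nth_rewrite 1 [← cfc_id' ℂ T]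
      rw [← cfc_mul (fun t : ℂ => t) _ _ continuousOn_id (hχc lam h), ← cfc_const_mul _ _ _ (hχc lam h)]
      refine cfc_congr fun t _ => ?_
      by_cases ht : t = τ lam <;> simp [hχ, ht]
    exact DFunLike.congr_fun h1 u
  · refine Submodule.span_induction (p := fun u _ => cfc X T u = u) ?_ (map_zero _)
      (fun u v _ _ hu hv => by rw [map_add, hu, hv]) (fun c u _ hu => by rw [map_smul, hu]) hu
    intro u hu
    obtain ⟨lam, h, hu⟩ := mem_iUnion₂.1 hu
    have hTu : T u = τ lam • u := hT.apply_eigenvector (hlamne lam h) hu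
    -- Factoring `1 - X` through `t - τ lam` shows that `1 - Q` kills the eigenvector. The value `0
    -- / 0 = 0` at `τ lam` is harmless, since `1 - X` vanishes there.
    have hg : ContinuousOn (fun t : ℂ => (1 - X t) / (t - τ lam)) (spectrum ℂ T) := fun t ht => by
      rcases eq_or_ne t (τ lam) with rfl | hne
      · exact hisoc lam h _
      · exact (hone t ht).div (by fun_prop) (sub_ne_zero.2 hne)
    have h1 : cfc (fun t : ℂ => (1 - X t) / (t - τ lam)) T * (T - τ lam • 1) = 1 - cfc X T := by
      have h2 : cfc (fun t : ℂ => t - τ lam) T = T - τ lam • 1 := by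
        rw [cfc_sub (fun t : ℂ => t) _ _ continuousOn_id continuousOn_const, cfc_id' ℂ T, cfc_const _ T,
          Algebra.algebraMap_eq_smul_one]
      rw [← h2, ← cfc_mul _ _ _ hg (by fun_prop), ← hsub]
      refine cfc_congr fun t _ => ?_
      rcases eq_or_ne t (τ lam) with rfl | hne
      · simp [hXone lam h]
      · exact div_mul_cancel₀ _ (sub_ne_zero.2 hne)
    have h3 := DFunLike.congr_fun h1 u
    have h4 : (T - τ lam • (1 : H →L[ℂ] H)) u = 0 := by simp [hTu]
    rw [mul_apply_eq_comp, h4, map_zero] at h3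
    exact (sub_eq_zero.1 h3.symm).symm
  · rw [← hRk k]
    exact cfc_commute_cfc _ _ _
  · refine lt_of_le_of_lt ?_ (hs3 lam h)
    rw [← hfval, ← hsub, ← cfc_mul _ _ _ hfc hone]
    have hs0 : 0 ≤ s := (norm_nonneg _).trans hs1
    refine norm_cfc_le hs0 fun t ht => ?_
    -- The point `0` corresponds to infinity in the spectrum of `A`, where the filter has the value
    -- `w_N`.
    rcases eq_or_ne t 0 with rfl | ht0
    · have h1 : X 0 = 0 := Finset.sum_eq_zero fun lam h => if_neg (hτ0 lam h).symm
      simpa [hf, h1] using hs1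
    · by_cases hl : ∃ lam ∈ Λ, z₀ - t⁻¹ = ((lam : ℝ) : ℂ)
      · obtain ⟨lam, h, hl⟩ := hl
        rw [hτeq t lam hl, hXone lam h]
        simpa using hs0
      · push Not at hl
        have h1 : X t = 0 := Finset.sum_eq_zero fun lam h => if_neg fun he =>
          hl lam h (by rw [he]; simp [hτ])
        have h2 : f t = F.r (z₀ - t⁻¹) := by
          rw [hf, RationalFilter.r]
          simp only
          congr 1
          refine Finset.sum_congr rfl fun k _ => ?_
          have h3 := hnode k t ht
          have h4 : F.z k - (z₀ - t⁻¹) = (1 + (F.z k - z₀) * t) / t := by field_simp; ring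
          rw [h4, inv_div]
        rw [h1, sub_zero, mul_one, h2]
        exact hs2 _ (hspec t ht ht0) hl

end Projection

/-! ### Winding numbers and the spectrum of the filter. -/

section Contour

open Metric
open scoped NNReal

variable {Θ : ℝ → ℂ} {K : ℝ≥0}

lemma exists_ball_norm_sub_lt (hΘ : LipschitzOnWith K Θ (Icc 0 1)) {ν : ℂ}
    (hν : ∀ t ∈ Icc (0 : ℝ) 1, Θ t ≠ ν) :
    ∃ ε > 0, ∀ z ∈ ball ν ε, ∀ t ∈ Icc (0 : ℝ) 1, ‖z - ν‖ < ‖Θ t - ν‖ := by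
  obtain ⟨t₀, ht₀, hmin⟩ := isCompact_Icc.exists_isMinOn (nonempty_Icc.2 (zero_le_one' ℝ))
    (hΘ.continuousOn.sub (continuousOn_const (c := ν))).norm
  refine ⟨‖Θ t₀ - ν‖, norm_pos_iff.2 (sub_ne_zero.2 (hν t₀ ht₀)), fun z hz t ht => ?_⟩
  rw [mem_ball, dist_eq_norm] at hz
  exact hz.trans_le (hmin ht)

/-- Winding numbers are locally constant off the curve. Openness lets upper hemicontinuity of the
spectrum keep perturbed spectra inside this set. -/
lemma isOpen_setOf_windingNumber_eq_zero_or_one (hΘ : LipschitzOnWith K Θ (Icc 0 1))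
    (hclosed : Θ 0 = Θ 1) :
    IsOpen {ν : ℂ | (∀ t ∈ Icc (0 : ℝ) 1, Θ t ≠ ν) ∧
      (windingNumber Θ ν = 0 ∨ windingNumber Θ ν = 1)} := by
  rw [Metric.isOpen_iff]
  rintro ν ⟨hν, hw⟩
  obtain ⟨ε, hε, hball⟩ := exists_ball_norm_sub_lt hΘ hν
  refine ⟨ε, hε, fun z hz => ⟨fun t ht h => ?_, ?_⟩⟩
  · have := hball z hz t ht
    rw [h] at this
    exact lt_irrefl _ this
  · rwa [windingNumber_eq_of_norm_sub_lt hΘ hclosed (hball z hz)]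

variable {V : Type*} [NormedAddCommGroup V] [NormedSpace ℂ V] [CompleteSpace V]
  {S : V →L[ℂ] V} {M : Set ℂ}

lemma norm_le_sSup_spectrum_diff {μ : ℂ} (hμ : μ ∈ spectrum ℂ S \ M) :
    ‖μ‖ ≤ sSup ((fun μ : ℂ => ‖μ‖) '' (spectrum ℂ S \ M)) := by
  refine le_csSup ⟨‖S‖ * ‖(1 : V →L[ℂ] V)‖, ?_⟩ (mem_image_of_mem _ hμ)
  rintro _ ⟨ν, hν, rfl⟩
  exact spectrum.norm_le_norm_mul_of_mem hν.1

/-- A spectral point on the curve would not be in `M`, hence would have modulus at most `μ_*`, but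
the curve lies outside that circle. -/
lemma IsFilterContour.mem_resolventSet (hΘ : IsFilterContour S M Θ) {t : ℝ}
    (ht : t ∈ Icc (0 : ℝ) 1) : Θ t ∈ resolventSet ℂ S := by
  by_contra h
  exact (hΘ.outside t ht).not_ge (norm_le_sSup_spectrum_diff ⟨h, hΘ.avoids t ht⟩)

lemma IsFilterContour.spectrum_subset (hΘ : IsFilterContour S M Θ) :
    spectrum ℂ S ⊆ {ν : ℂ | (∀ t ∈ Icc (0 : ℝ) 1, Θ t ≠ ν) ∧
      (windingNumber Θ ν = 0 ∨ windingNumber Θ ν = 1)} := by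
  refine fun ν hν => ⟨fun t ht h => ?_, ?_⟩
  · exact (h ▸ hν : Θ t ∈ spectrum ℂ S) (hΘ.mem_resolventSet ht)
  · by_cases hM : ν ∈ M
    · exact Or.inr (hΘ.encloses ν hM)
    · exact Or.inl (hΘ.excludes ν ⟨hν, hM⟩)

lemma commute_resolvent {V : Type*} [NormedAddCommGroup V] [NormedSpace ℂ V]
    {X Q : V →L[ℂ] V} (h : Commute X Q) {z : ℂ} (hz : z ∈ resolventSet ℂ X) :
    Commute (resolvent X z) Q := by
  have h1 : Commute (algebraMap ℂ (V →L[ℂ] V) z - X) Q := Commute.sub_left (Algebra.commutes z Q) h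
  have h2 := resolvent_mul_cancel hz
  have h3 := mul_resolvent_cancel hz
  calc resolvent X z * Q
      = resolvent X z * (Q * ((algebraMap ℂ (V →L[ℂ] V) z - X) * resolvent X z)) := by
        rw [h3, mul_one]
    _ = (resolvent X z * (algebraMap ℂ (V →L[ℂ] V) z - X)) * (Q * resolvent X z) := by
        rw [← mul_assoc Q, ← h1.eq]; simp only [mul_assoc]
    _ = Q * resolvent X z := by rw [h2, one_mul]

end Contour

/-! ### The filter on the complement of the eigenspace. -/

section Compression

open Metric

variable {V V₁ : Type*} [NormedAddCommGroup V] [NormedSpace ℂ V]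
  [NormedAddCommGroup V₁] [NormedSpace ℂ V₁] {S : V →L[ℂ] V} {S₁ : V₁ →L[ℂ] V₁}
  {i : V₁ →L[ℂ] V} {p : V →L[ℂ] V₁}

/-- The inverse is `p R(z) i`. Here `i` stands for the inclusion of an invariant complement and `p`
for the projection onto it. -/
lemma mem_resolventSet_of_compression (hpi : ∀ x, p (i x) = x) (hi : ∀ x, i (S₁ x) = S (i x))
    (hp : ∀ v, p (S v) = S₁ (p v)) {z : ℂ} (hz : z ∈ resolventSet ℂ S) :
    z ∈ resolventSet ℂ S₁ := by
  refine mem_resolventSet_of_mul_eq_one (b := p.comp ((resolvent S z).comp i)) ?_ ?_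
  · refine ContinuousLinearMap.ext fun x => ?_
    have h1 := congrArg p (sub_resolvent_apply hz (i x))
    rw [map_sub, map_smul, hp, hpi] at h1
    simpa [Algebra.algebraMap_eq_smul_one] using h1
  · refine ContinuousLinearMap.ext fun x => ?_
    have h1 : resolvent S z (i (z • x - S₁ x)) = i x := by
      rw [map_sub, map_smul, hi]
      exact resolvent_apply_eq_of_sub_eq hz rfl
    have h2 := congrArg p h1
    rw [hpi] at h2
    simpa [Algebra.algebraMap_eq_smul_one] using h2

lemma map_resolvent_of_compression (hpi : ∀ x, p (i x) = x) (hi : ∀ x, i (S₁ x) = S (i x))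
    (hp : ∀ v, p (S v) = S₁ (p v)) {z : ℂ} (hz : z ∈ resolventSet ℂ S) (v : V) :
    p (resolvent S z v) = resolvent S₁ z (p v) := by
  refine (resolvent_apply_eq_of_sub_eq (mem_resolventSet_of_compression hpi hi hp hz) ?_).symm
  rw [← hp, ← map_smul, ← map_sub, sub_resolvent_apply hz]

variable [CompleteSpace V₁] {M : Set ℂ} {Θ : ℝ → ℂ}
  {H : Type*} [NormedAddCommGroup H] [NormedSpace ℂ H] [CompleteSpace H]
  {j : V →L[ℂ] H} {b : H →L[ℂ] H}

/-- Compression creates no new spectrum. A point of `M` is isolated in the spectrum of `S` and lies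
beyond the norm of `b`, so the intertwining argument removes it from the spectrum of `S₁`. -/
lemma IsFilterContour.spectrum_compression_subset (hΘ : IsFilterContour S M Θ) (hM : M.Finite)
    (hpi : ∀ x, p (i x) = x) (hi : ∀ x, i (S₁ x) = S (i x)) (hp : ∀ v, p (S v) = S₁ (p v))
    (hj : Function.Injective j) (hb : ∀ x, j (S (i x)) = b (j (i x)))
    (hbM : ∀ μ ∈ M, ‖b‖ < ‖μ‖) : spectrum ℂ S₁ ⊆ spectrum ℂ S \ M := by
  obtain ⟨K, hlip⟩ := hΘ.curve.lipschitz
  have hclosed := hΘ.curve.closed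
  have hres : ∀ z ∈ resolventSet ℂ S, z ∈ resolventSet ℂ S₁ := fun z hz =>
    mem_resolventSet_of_compression hpi hi hp hz
  refine fun μ hμ => ⟨fun h => hμ (hres μ h), fun hμM => hμ ?_⟩
  obtain ⟨ε₁, hε₁, hball⟩ := exists_ball_norm_sub_lt hlip
    (fun t ht h => hΘ.avoids t ht (h ▸ hμM) : ∀ t ∈ Icc (0 : ℝ) 1, Θ t ≠ μ)
  have h1 : ∀ᶠ z in 𝓝 μ, z ∈ ball μ ε₁ := ball_mem_nhds μ hε₁
  have h2 : ∀ᶠ z in 𝓝 μ, z ∉ M \ {μ} :=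
    (hM.subset sdiff_subset).isClosed.isOpen_compl.mem_nhds (by simp)
  have h3 : ∀ᶠ z in 𝓝 μ, ‖b‖ * ‖(1 : H →L[ℂ] H)‖ < ‖z‖ := by
    refine (isOpen_lt continuous_const continuous_norm).mem_nhds ?_
    exact lt_of_le_of_lt (mul_le_of_le_one_right (norm_nonneg _)
      ContinuousLinearMap.norm_id_le) (hbM μ hμM)
  obtain ⟨ε, hε, hsub⟩ := Metric.eventually_nhds_iff_ball.1 (h1.and (h2.and h3))
  refine mem_resolventSet_of_intertwining (j := j.comp i) (b := b)
    (hj.comp (Function.LeftInverse.injective hpi)) (fun x => ?_) hε (fun z hz hne => ?_)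
    fun z hz => ?_
  · have h4 := hb x
    rw [← hi] at h4
    exact h4
  · obtain ⟨hz1, hz2, -⟩ := hsub z hz
    -- Near `μ` all winding numbers are 1, whereas a spectral point outside `M` must have winding
    -- number 0.
    refine hres z (by_contra fun hzS => ?_)
    have hw0 := hΘ.excludes z ⟨hzS, fun h => hz2 ⟨h, hne⟩⟩
    have hw1 := windingNumber_eq_of_norm_sub_lt hlip hclosed (hball z hz1)
    rw [hw0, hΘ.encloses μ hμM] at hw1
    exact zero_ne_one hw1
  · exact spectrum.mem_resolventSet_of_norm_lt_mul (hsub z hz).2.2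

variable [CompleteSpace V]

lemma IsFilterContour.map_spectralProjector_eq_zero (hΘ : IsFilterContour S M Θ)
    (hpi : ∀ x, p (i x) = x) (hi : ∀ x, i (S₁ x) = S (i x)) (hp : ∀ v, p (S v) = S₁ (p v))
    (hspec : spectrum ℂ S₁ ⊆ spectrum ℂ S \ M) (v : V) : p (spectralProjector Θ S v) = 0 := by
  obtain ⟨K, hlip⟩ := hΘ.curve.lipschitz
  have hclosed := hΘ.curve.closed
  have hΘS : ∀ t ∈ Icc (0 : ℝ) 1, Θ t ∈ resolventSet ℂ S := fun t ht => hΘ.mem_resolventSet ht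
  rcases subsingleton_or_nontrivial V₁ with hsub | hnt
  · exact Subsingleton.elim _ _
  · obtain ⟨μ₁, hμ₁⟩ := spectrum.nonempty S₁
    have hμ₁le := norm_le_sSup_spectrum_diff (hspec hμ₁)
    -- The curve avoids the disc of radius `μ_*`, so its winding number about the centre is that
    -- about any spectral point of `S₁`. Such a point exists because `V₁` is nontrivial.
    have hw : windingNumber Θ 0 = 0 := by
      refine Eq.trans ?_ (hΘ.excludes μ₁ (hspec hμ₁))
      refine (windingNumber_eq_of_norm_sub_lt hlip hclosed fun t ht => ?_).symm
      rw [sub_zero, sub_zero]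
      exact hμ₁le.trans_lt (hΘ.outside t ht)
    have hzero : contourIntegral Θ (resolvent S₁) = 0 :=
      contourIntegral_resolvent_eq_zero hlip hclosed ((norm_nonneg _).trans hμ₁le)
        (fun μ hμ => mem_closedBall_zero_iff.2 (norm_le_sSup_spectrum_diff (hspec hμ)))
        hΘ.outside hw
    have h1 := map_contourIntegral hlip (p.comp (ContinuousLinearMap.apply ℂ V v))
      (continuousOn_resolvent_comp hlip hΘS)
    have h2 := map_contourIntegral hlip (ContinuousLinearMap.apply ℂ V₁ (p v))
      (continuousOn_resolvent_comp hlip fun t ht =>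
        mem_resolventSet_of_compression hpi hi hp (hΘS t ht))
    have h3 : p (contourIntegral Θ (resolvent S) v) = 0 := by
      refine h1.trans (Eq.trans (contourIntegral_congr fun t ht => ?_)
        (h2.symm.trans (by rw [hzero, map_zero])))
      exact map_resolvent_of_compression hpi hi hp (hΘS t ht) v
    rw [spectralProjector, smul_apply, map_smul, h3, smul_zero]

/-- The spectral projector of `S` has its range in the range of a projection `Q` commuting
with `S`, if the complementary part of `S` is dominated in a larger space `H` by an operator `b`
with norm less than the moduli of the points that the curve encloses. -/
lemma IsFilterContour.spectralProjector_mem (hΘ : IsFilterContour S M Θ) (hM : M.Finite)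
    {Q : V →L[ℂ] V} (hQ : ∀ v, Q (Q v) = Q v) (hSQ : ∀ v, S (Q v) = Q (S v))
    (hj : Function.Injective j) (hb : ∀ v, Q v = 0 → j (S v) = b (j v))
    (hbM : ∀ μ ∈ M, ‖b‖ < ‖μ‖) (v : V) :
    Q (spectralProjector Θ S v) = spectralProjector Θ S v := by
  let V₀ : Submodule ℂ V := LinearMap.ker (Q : V →ₗ[ℂ] V)
  have hmem : ∀ v, v ∈ V₀ ↔ Q v = 0 := fun v => LinearMap.mem_ker
  have : CompleteSpace V₀ := Q.isClosed_ker.completeSpace_coe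
  let p : V →L[ℂ] V₀ := (1 - Q).codRestrict V₀ fun v => by
    rw [hmem]; simp [hQ]
  have hp : ∀ v, (p v : V) = v - Q v := fun v => rfl
  let S₁ : V₀ →L[ℂ] V₀ := p.comp (S.comp V₀.subtypeL)
  have hpi : ∀ x : V₀, p (V₀.subtypeL x) = x := fun x => by
    refine Subtype.ext ?_
    change (x : V) - Q x = x
    rw [(hmem _).1 x.2, sub_zero]
  have hi : ∀ x : V₀, V₀.subtypeL (S₁ x) = S (V₀.subtypeL x) := fun x => by
    change S x - Q (S x) = S x
    rw [← hSQ, (hmem _).1 x.2, map_zero, sub_zero]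
  have hpS : ∀ v, p (S v) = S₁ (p v) := fun v => by
    refine Subtype.ext (Eq.trans ?_ (hi (p v)).symm)
    change S v - Q (S v) = S (v - Q v)
    rw [map_sub, hSQ]
  have hspec := hΘ.spectrum_compression_subset hM hpi hi hpS hj
    (fun x => hb x ((hmem _).1 x.2)) hbM
  have h := congrArg Subtype.val (hΘ.map_spectralProjector_eq_zero hpi hi hpS hspec v)
  rw [hp] at h
  exact (sub_eq_zero.1 h).symm

end Compression

/-! ### Perturbation of the spectral projector. -/

section Perturbation

open Metric
open scoped NNReal

variable {V : Type*} [NormedAddCommGroup V] [NormedSpace ℂ V] [CompleteSpace V]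
  {Θ : ℝ → ℂ} {K : ℝ≥0}

/-- The spectral projector of a finite-rank perturbation of a multiple of the identity is
idempotent if the winding numbers of the curve about the spectrum are `0` or `1`. -/
lemma spectralProjector_idempotent_of_finiteRank (hΘ : LipschitzOnWith K Θ (Icc 0 1))
    (hclosed : Θ 0 = Θ 1) {X : V →L[ℂ] V}
    (hX : spectrum ℂ X ⊆ {ν : ℂ | (∀ t ∈ Icc (0 : ℝ) 1, Θ t ≠ ν) ∧
      (windingNumber Θ ν = 0 ∨ windingNumber Θ ν = 1)})
    {c : ℂ} {U : Submodule ℂ V} [FiniteDimensional ℂ U] (hU : ∀ v, X v - c • v ∈ U) (v : V) :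
    spectralProjector Θ X (spectralProjector Θ X v) = spectralProjector Θ X v := by
  have hΘX : ∀ t ∈ Icc (0 : ℝ) 1, Θ t ∈ resolventSet ℂ X := fun t ht =>
    by_contra fun h => (hX h).1 t ht rfl
  -- A finite-dimensional invariant subspace containing `v`; over `ℂ` it is spanned by generalized
  -- eigenvectors, on which the projector is scalar.
  let W : Submodule ℂ V := Submodule.span ℂ {v} ⊔ U
  have hUW : U ≤ W := le_sup_right
  have hXW : ∀ w ∈ W, (X : V →ₗ[ℂ] V) w ∈ W := fun w hw => by
    have h1 := W.add_mem (hUW (hU w)) (W.smul_mem c hw)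
    rwa [sub_add_cancel] at h1
  let f : Module.End ℂ W := (X : V →ₗ[ℂ] V).restrict hXW
  have hf : ∀ (ν : ℂ) (n : ℕ) (w : W), ((((f - algebraMap ℂ (Module.End ℂ W) ν) ^ n) w : W) : V) =
      ((X - ν • (1 : V →L[ℂ] V)) ^ n) w := fun ν n => by
    induction n with
    | zero => intro w; simp
    | succ n ih =>
      intro w
      rw [pow_succ, pow_succ, Module.End.mul_apply, ih, mul_apply_eq_comp]
      congr 1
  have hmem : v ∈ W := Submodule.mem_sup_left (Submodule.mem_span_singleton_self v)
  have key : ∀ w : W, spectralProjector Θ X (spectralProjector Θ X (w : V)) =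
      spectralProjector Θ X (w : V) := fun w => by
    have hw : w ∈ ⨆ ν : ℂ, Module.End.maxGenEigenspace f ν := by
      rw [Module.End.iSup_maxGenEigenspace_eq_top]; trivial
    refine Submodule.iSup_induction _ (motive := fun w : W =>
      spectralProjector Θ X (spectralProjector Θ X (w : V)) = spectralProjector Θ X (w : V)) hw
      (fun ν w hw => ?_) (by simp) fun w₁ w₂ h₁ h₂ => by
        rw [Submodule.coe_add, map_add, map_add, h₁, h₂]
    rw [Module.End.mem_maxGenEigenspace] at hw
    obtain ⟨n, hn⟩ := hw
    have hn' : ((X - ν • (1 : V →L[ℂ] V)) ^ n) (w : V) = 0 := by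
      rw [← hf]
      exact congrArg Subtype.val hn
    by_cases hν : ν ∈ spectrum ℂ X
    · have hP := spectralProjector_apply_of_pow_apply_eq_zero hΘ hclosed hΘX (hX hν).1 hn'
      rw [hP, map_smul, hP]
      rcases (hX hν).2 with h | h <;> simp [h]
    · have hunit : IsUnit (X - ν • (1 : V →L[ℂ] V)) := by
        have h1 : IsUnit (algebraMap ℂ (V →L[ℂ] V) ν - X) := not_not.1 hν
        rw [← neg_sub, Algebra.algebraMap_eq_smul_one] at h1
        exact (IsUnit.neg_iff _).1 h1
      obtain ⟨u, hu⟩ := hunit.pow n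
      have h0 : (w : V) = 0 := by
        have h2 : ((↑u⁻¹ : V →L[ℂ] V) * ↑u) (w : V) = w := by rw [Units.inv_mul]; rfl
        rw [mul_apply_eq_comp, hu, hn', map_zero] at h2
        exact h2.symm
      simp [h0]
  exact key ⟨v, hmem⟩

/-- Invertibility follows from `z - X = (z - S) (1 - R_S(z) (X - S))`. The bound follows by
absorbing half of `‖R_X(z)‖` in the resolvent identity. -/
lemma exists_resolvent_bound_near {S : V →L[ℂ] V} (hΘ : LipschitzOnWith K Θ (Icc 0 1))
    (hS : ∀ t ∈ Icc (0 : ℝ) 1, Θ t ∈ resolventSet ℂ S) :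
    ∃ ε > 0, ∃ L > 0, ∀ X : V →L[ℂ] V, ‖X - S‖ < ε → ∀ t ∈ Icc (0 : ℝ) 1,
      Θ t ∈ resolventSet ℂ X ∧ ‖resolvent X (Θ t)‖ ≤ L := by
  obtain ⟨L₀, hL₀⟩ := isCompact_Icc.exists_bound_of_continuousOn
    (continuousOn_resolvent_comp hΘ hS)
  set L₁ := max L₀ 1 with hL₁
  have hpos : 0 < L₁ := zero_lt_one.trans_le (le_max_right _ _)
  refine ⟨(2 * L₁)⁻¹, by positivity, 2 * L₁, by positivity, fun X hX t ht => ?_⟩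
  have hR : ‖resolvent S (Θ t)‖ ≤ L₁ := (hL₀ t ht).trans (le_max_left _ _)
  have hsmall : ‖X - S‖ * L₁ ≤ 1 / 2 := by
    calc ‖X - S‖ * L₁ ≤ (2 * L₁)⁻¹ * L₁ := by gcongr
      _ = 1 / 2 := by field_simp
  have hmem : Θ t ∈ resolventSet ℂ X := by
    have h1 : ‖resolvent S (Θ t) * (X - S)‖ < 1 := by
      calc _ ≤ ‖resolvent S (Θ t)‖ * ‖X - S‖ := norm_mul_le _ _
        _ ≤ L₁ * ‖X - S‖ := by gcongr
        _ < 1 := by linarith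
    have h2 : IsUnit (algebraMap ℂ (V →L[ℂ] V) (Θ t) - S) := hS t ht
    have h3 := h2.mul (isUnit_one_sub_of_norm_lt_one h1)
    rw [mul_sub, mul_one, ← mul_assoc, mul_resolvent_cancel (hS t ht), one_mul,
      sub_sub_sub_cancel_right] at h3
    exact h3
  refine ⟨hmem, ?_⟩
  have h1 := spectrum.resolvent_sub_resolvent hmem (hS t ht)
  have h2 : ‖resolvent X (Θ t)‖ ≤ ‖resolvent X (Θ t)‖ * (1 / 2) + L₁ := by
    calc ‖resolvent X (Θ t)‖
        = ‖resolvent X (Θ t) * (X - S) * resolvent S (Θ t) + resolvent S (Θ t)‖ := by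
          rw [← h1, sub_add_cancel]
      _ ≤ ‖resolvent X (Θ t) * (X - S) * resolvent S (Θ t)‖ + ‖resolvent S (Θ t)‖ :=
          norm_add_le _ _
      _ ≤ ‖resolvent X (Θ t)‖ * ‖X - S‖ * L₁ + L₁ := by
          gcongr
          exact (norm_mul_le _ _).trans (by gcongr; exact norm_mul_le _ _)
      _ ≤ _ := by rw [mul_assoc]; gcongr
  linarith

/-- In `R_X (X - S) R_S e` the vector `R_S e` stays in `E`, so only the size of `X - S` on `E`
enters. With `E = ⊤` this gives convergence in norm, with the eigenspace it gives the rate. -/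
lemma norm_spectralProjector_sub_apply_le {S X : V →L[ℂ] V} (hΘ : LipschitzOnWith K Θ (Icc 0 1))
    {L : ℝ} (hL : 0 ≤ L)
    (hS : ∀ t ∈ Icc (0 : ℝ) 1, Θ t ∈ resolventSet ℂ S ∧ ‖resolvent S (Θ t)‖ ≤ L)
    (hX : ∀ t ∈ Icc (0 : ℝ) 1, Θ t ∈ resolventSet ℂ X ∧ ‖resolvent X (Θ t)‖ ≤ L)
    {E : Submodule ℂ V} (hE : ∀ t ∈ Icc (0 : ℝ) 1, ∀ e ∈ E, resolvent S (Θ t) e ∈ E)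
    {η : ℝ} (hη0 : 0 ≤ η) (hη : ∀ e ∈ E, ‖(X - S) e‖ ≤ η * ‖e‖) {e : V} (he : e ∈ E) :
    ‖spectralProjector Θ X e - spectralProjector Θ S e‖ ≤
      ‖(2 * Real.pi * Complex.I)⁻¹‖ * K * L ^ 2 * η * ‖e‖ := by
  have hcX := continuousOn_resolvent_comp hΘ fun t ht => (hX t ht).1
  have hcS := continuousOn_resolvent_comp hΘ fun t ht => (hS t ht).1
  have h1 : spectralProjector Θ X e - spectralProjector Θ S e = (2 * Real.pi * Complex.I)⁻¹ •
      contourIntegral Θ (fun z => (resolvent X z - resolvent S z) e) := by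
    have h2 := map_contourIntegral hΘ (ContinuousLinearMap.apply ℂ V e)
      (f := fun z => resolvent X z - resolvent S z) (hcX.sub hcS)
    have h3 := contourIntegral_sub hΘ hcX hcS
    rw [spectralProjector, spectralProjector, smul_apply, smul_apply, ← smul_sub, ← sub_apply, ← h3]
    congr 1
  have hbound : ∀ t ∈ Icc (0 : ℝ) 1, ‖(resolvent X (Θ t) - resolvent S (Θ t)) e‖ ≤
      L * (η * (L * ‖e‖)) := fun t ht => by
    rw [spectrum.resolvent_sub_resolvent (hX t ht).1 (hS t ht).1, mul_assoc, mul_apply_eq_comp,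
      mul_apply_eq_comp]
    refine (ContinuousLinearMap.le_of_opNorm_le _ (hX t ht).2 _).trans ?_
    gcongr
    refine (hη _ (hE t ht e he)).trans ?_
    gcongr
    exact ContinuousLinearMap.le_of_opNorm_le _ (hS t ht).2 _
  rw [h1, norm_smul]
  calc _ ≤ ‖(2 * Real.pi * Complex.I)⁻¹‖ * (K * (L * (η * (L * ‖e‖)))) := by
        gcongr
        exact norm_contourIntegral_le hΘ hbound
    _ = _ := by ring

end Perturbation

/-! ### The gap between ranges of projections. -/

section Gap

variable {V : Type*} [NormedAddCommGroup V] [NormedSpace ℂ V]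

lemma oneSidedGap_nonneg (M L : Submodule ℂ V) : 0 ≤ oneSidedGap M L := by
  refine Real.sSup_nonneg ?_
  rintro _ ⟨m, -, rfl⟩
  exact Metric.infDist_nonneg

lemma gap_nonneg (M L : Submodule ℂ V) : 0 ≤ gap M L :=
  (oneSidedGap_nonneg M L).trans (le_max_left _ _)

lemma oneSidedGap_le {M L : Submodule ℂ V} {c : ℝ} (hc : 0 ≤ c)
    (h : ∀ m ∈ M, ‖m‖ = 1 → ∃ l ∈ L, ‖m - l‖ ≤ c) : oneSidedGap M L ≤ c := by
  refine Real.sSup_le ?_ hc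
  rintro _ ⟨m, ⟨hm, hm1⟩, rfl⟩
  obtain ⟨l, hl, hle⟩ := h m hm hm1
  refine (Metric.infDist_le_dist_of_mem (SetLike.mem_coe.2 hl)).trans ?_
  rwa [dist_eq_norm]

variable [CompleteSpace V]

/-- The gap between the ranges of two nearby projections is controlled by their difference on
one of the ranges. -/
lemma gap_range_le {P P' : V →L[ℂ] V} {E : Submodule ℂ V} (hPE : ∀ v, P v ∈ E)
    (hP : ∀ e ∈ E, P e = e) (hP' : ∀ v, P' (P' v) = P' v) {η : ℝ} (hη0 : 0 ≤ η)
    (hη : ∀ e ∈ E, ‖P' e - P e‖ ≤ η * ‖e‖) (hsmall : ‖P' - P‖ * (‖P‖ + 1) ≤ 1 / 2) :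
    gap E (LinearMap.range (P' : V →ₗ[ℂ] V)) ≤ (2 * ‖P‖ + 1) * η := by
  have hP0 := norm_nonneg P
  refine max_le (oneSidedGap_le (by positivity) fun e he he1 => ⟨P' e, ⟨e, rfl⟩, ?_⟩)
    (oneSidedGap_le (by positivity) fun m hm hm1 => ?_)
  · have h := hη e he
    rw [hP e he, he1, mul_one, norm_sub_rev] at h
    nlinarith
  · have hle1 : ‖P' - P‖ ≤ 1 := by nlinarith [norm_nonneg (P' - P)]
    have hP'le : ‖P'‖ ≤ ‖P‖ + 1 := by
      have := norm_add_le (P' - P) P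
      rw [sub_add_cancel] at this
      linarith
    -- On the range of `P'` one has `1 - a = P' P`. Solving `(1 - a) u = m` gives `u` in that range
    -- with `‖u‖ ≤ 2` and `m = P' (P u)`, so `m - P u` is the difference of the projections at a
    -- vector of `E`.
    set a : V →L[ℂ] V := P' * (P' - P) with ha
    have hanorm : ‖a‖ ≤ 1 / 2 := by
      calc ‖a‖ ≤ ‖P'‖ * ‖P' - P‖ := norm_mul_le _ _
        _ ≤ (‖P‖ + 1) * ‖P' - P‖ := by gcongr
        _ ≤ 1 / 2 := by rwa [mul_comm]
    obtain ⟨Y, hY⟩ := isUnit_one_sub_of_norm_lt_one (lt_of_le_of_lt hanorm (by norm_num))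
    set u := (↑Y⁻¹ : V →L[ℂ] V) m with hu
    have hYu : u - a u = m := by
      have h1 : ((Y : V →L[ℂ] V) * ↑Y⁻¹) m = m := by rw [Units.mul_inv]; rfl
      rw [hY] at h1
      exact h1
    have hm' : P' m = m := by
      obtain ⟨x, rfl⟩ := hm
      exact hP' x
    have hau : a u = P' u - P' (P u) := by
      change P' (P' u - P u) = _
      rw [map_sub, hP']
    have hu' : P' u = u := by
      have h1 : u = m + a u := by rw [← hYu]; abel
      have h2 : P' (a u) = a u := by rw [hau, map_sub, hP', hP']
      rw [h1, map_add, hm', h2]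
    have hmP : m = P' (P u) := by rw [← hYu, hau, hu', sub_sub_cancel]
    have hunorm : ‖u‖ ≤ 2 := by
      have h1 : ‖u‖ ≤ ‖m‖ + ‖a u‖ := by
        have h2 : u = m + a u := by rw [← hYu]; abel
        calc ‖u‖ = ‖m + a u‖ := by rw [← h2]
          _ ≤ _ := norm_add_le _ _
      have h3 := a.le_of_opNorm_le hanorm u
      linarith
    refine ⟨P u, hPE u, ?_⟩
    have h4 := hη (P u) (hPE u)
    rw [hP (P u) (hPE u), ← hmP] at h4
    have h5 := P.le_opNorm u
    calc ‖m - P u‖ ≤ η * ‖P u‖ := h4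
      _ ≤ η * (‖P‖ * 2) := by gcongr; exact h5.trans (by gcongr)
      _ ≤ _ := by nlinarith

end Gap

/-! ### The exact projector on `V`. -/

section ExactProjector

variable {H V : Type*} [NormedAddCommGroup H] [InnerProductSpace ℂ H]
  [NormedAddCommGroup V] [InnerProductSpace ℂ V] {A : H →ₗ.[ℂ] H} {Λ : Finset ℝ}
  {N : ℕ} {F : RationalFilter N}

lemma RationalFilter.op_apply {X : Type*} [NormedAddCommGroup X] [NormedSpace ℂ X]
    (F : RationalFilter N) (T : Fin N → X →L[ℂ] X) (x : X) :
    F.op T x = F.w (Fin.last N) • x + ∑ k : Fin N, F.w k.castSucc • T k x := by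
  simp [RationalFilter.op]

lemma RationalFilter.op_sub_op_apply {X : Type*} [NormedAddCommGroup X] [NormedSpace ℂ X]
    (F : RationalFilter N) (T T' : Fin N → X →L[ℂ] X) (x : X) :
    (F.op T - F.op T') x = ∑ k : Fin N, F.w k.castSucc • (T k - T' k) x := by
  simp [RationalFilter.op, smul_sub]

lemma RationalFilter.W_nonneg (F : RationalFilter N) : 0 ≤ F.W :=
  Finset.sum_nonneg fun _ _ => norm_nonneg _

lemma RationalFilter.sum_norm_le_W (F : RationalFilter N) :
    ∑ k : Fin N, ‖F.w k.castSucc‖ ≤ F.W := by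
  rw [RationalFilter.W, Fin.sum_univ_castSucc]
  exact le_add_of_nonneg_right (norm_nonneg _)

lemma IsEigenvalueCluster.finiteDimensional (hΛ : IsEigenvalueCluster A Λ) :
    FiniteDimensional ℂ (exactEigenspace A Λ) := by
  have h : exactEigenspace A Λ = ⨆ lam : Λ, Submodule.span ℂ (eigenvectors A lam) := by
    rw [exactEigenspace, Submodule.span_iUnion₂, iSup_subtype]
  have : ∀ lam : Λ, FiniteDimensional ℂ (Submodule.span ℂ (eigenvectors A lam)) := fun lam =>
    hΛ.finite_mult lam lam.2
  rw [h]
  exact Submodule.finiteDimensional_iSup _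

lemma SeparatesSpectrum.op_apply_eigenvector (hΛ : IsEigenvalueCluster A Λ)
    (hF : SeparatesSpectrum A Λ F) {lam : ℝ} (h : lam ∈ Λ) {u : H} (hu : u ∈ eigenvectors A lam) :
    F.op (fun k => resolventOf A (F.z k)) u = F.r (lam : ℂ) • u := by
  rw [RationalFilter.op_apply, RationalFilter.r, add_smul, Finset.sum_smul]
  congr 1
  refine Finset.sum_congr rfl fun k _ => ?_
  rw [(hF.isResolventAt k).apply_eigenvector (hF.node_ne k (hΛ.mem_spectrumOf h)) hu, smul_smul]

/-- A projection of `H` onto the exact eigenspace restricts to a bounded projection of `V`. -/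
lemma IsIntermediateSpace.exists_restrict_projection {ι : V →ₗ[ℂ] H}
    (hV : IsIntermediateSpace A Λ F ι) (hΛ : IsEigenvalueCluster A Λ) {Q : H →L[ℂ] H}
    (hQ : ∀ u, Q u ∈ exactEigenspace A Λ) :
    ∃ QV : V →L[ℂ] V, ∀ v, ι (QV v) = Q (ι v) := by
  have := hΛ.finiteDimensional
  obtain ⟨C, -, hC⟩ := hV.bounded
  let lift : exactEigenspace A Λ →ₗ[ℂ] V :=
    (LinearEquiv.ofInjective ι hV.injective).symm.toLinearMap ∘ₗ
      Submodule.inclusion hV.eigenspace_le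
  have hlift : ∀ x, ι (lift x) = x := fun x =>
    congrArg Subtype.val ((LinearEquiv.ofInjective ι hV.injective).apply_symm_apply
      (Submodule.inclusion hV.eigenspace_le x))
  -- The lift is continuous from the `H`-norm to the `V`-norm because the eigenspace is
  -- finite-dimensional.
  exact ⟨(LinearMap.toContinuousLinearMap lift).comp
    ((Q.codRestrict _ hQ).comp (ι.mkContinuous C hC)), fun v => hlift _⟩

variable [CompleteSpace H] [CompleteSpace V]

/-- The spectral projector of the exact filter is a projection onto the exact eigenspace, which is
invariant under the resolvents of the filter. -/
theorem exact_spectralProjector (hA : IsSelfAdjoint A) (hΛ : IsEigenvalueCluster A Λ)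
    (hF : SeparatesSpectrum A Λ F) {ι : V →ₗ[ℂ] H} (hV : IsIntermediateSpace A Λ F ι)
    {RV : Fin N → V →L[ℂ] V} (hRV : ∀ k v, ι (RV k v) = resolventOf A (F.z k) (ι v))
    {Θ : ℝ → ℂ}
    (hΘ : IsFilterContour (F.op RV) ((fun lam : ℝ => F.r (lam : ℂ)) '' (Λ : Set ℝ)) Θ) :
    (∀ v, spectralProjector Θ (F.op RV) v ∈ (exactEigenspace A Λ).comap ι) ∧
    (∀ e ∈ (exactEigenspace A Λ).comap ι, spectralProjector Θ (F.op RV) e = e) ∧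
    ∀ z ∈ resolventSet ℂ (F.op RV), ∀ e ∈ (exactEigenspace A Λ).comap ι,
      resolvent (F.op RV) z e ∈ (exactEigenspace A Λ).comap ι := by
  obtain ⟨K, hlip⟩ := hΘ.curve.lipschitz
  have hclosed := hΘ.curve.closed
  obtain ⟨Q, hQE, hQid, hQR, hQnorm⟩ := hF.exists_projection hA hΛ
  obtain ⟨QV, hQV⟩ := hV.exists_restrict_projection hΛ hQE
  obtain ⟨C, -, hC⟩ := hV.bounded
  set SH := F.op (fun k => resolventOf A (F.z k)) with hSH
  have hιS : ∀ v, ι (F.op RV v) = SH (ι v) := fun v => by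
    rw [hSH, RationalFilter.op_apply, RationalFilter.op_apply, map_add, map_smul, map_sum]
    simp only [map_smul, hRV]
  have hcommH : Commute SH Q := by
    rw [hSH, RationalFilter.op]
    refine Commute.add_left ((Commute.one_left Q).smul_left _) ?_
    exact Commute.sum_left _ _ _ fun k _ => (hQR k).smul_left _
  have hcomm : ∀ v, F.op RV (QV v) = QV (F.op RV v) := fun v => hV.injective <| by
    rw [hιS, hQV, hQV, hιS]
    exact DFunLike.congr_fun hcommH.eq (ι v)
  have hQVmem : ∀ v, ι v ∈ exactEigenspace A Λ ↔ QV v = v := fun v => by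
    refine ⟨fun h => hV.injective ?_, fun h => ?_⟩
    · rw [hQV, hQid _ h]
    · rw [← h, hQV]
      exact hQE _
  have hQVid : ∀ v, QV (QV v) = QV v := fun v => (hQVmem _).1 (by rw [hQV]; exact hQE _)
  refine ⟨fun v => (hQVmem _).2 ?_, fun e he => ?_, fun z hz e he => ?_⟩
  · refine hΘ.spectralProjector_mem (j := ι.mkContinuous C hC) (b := SH * (1 - Q))
      (Λ.finite_toSet.image _) hQVid hcomm hV.injective (fun v hv => ?_) ?_ v
    · change ι (F.op RV v) = SH (ι v - Q (ι v))
      rw [hιS, ← hQV, hv, map_zero, sub_zero]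
    · rintro _ ⟨lam, h, rfl⟩
      exact hQnorm lam h
  · have hle : exactEigenspace A Λ ≤ (LinearMap.eqLocus
        (spectralProjector Θ (F.op RV) : V →ₗ[ℂ] V) LinearMap.id).map ι := by
      refine Submodule.span_le.2 fun u hu => ?_
      have huE : u ∈ exactEigenspace A Λ := Submodule.subset_span hu
      obtain ⟨lam, h, hu⟩ := mem_iUnion₂.1 hu
      obtain ⟨v, rfl⟩ := hV.eigenspace_le huE
      refine ⟨v, ?_, rfl⟩
      have hSv : F.op RV v = F.r (lam : ℂ) • v := hV.injective <| by
        rw [hιS, map_smul, hF.op_apply_eigenvector hΛ h hu]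
      have hM : F.r (lam : ℂ) ∈ (fun lam : ℝ => F.r (lam : ℂ)) '' (Λ : Set ℝ) := ⟨lam, h, rfl⟩
      have h1 := spectralProjector_apply_of_pow_apply_eq_zero hlip hclosed
        (fun t ht => hΘ.mem_resolventSet ht) (ν := F.r (lam : ℂ))
        (fun t ht he => hΘ.avoids t ht (he ▸ hM)) (n := 1) (v := v) (by simp [hSv])
      rw [hΘ.encloses _ hM, one_smul] at h1
      exact h1
    obtain ⟨e', he', heq⟩ := hle he
    rw [← hV.injective heq]
    exact he'
  · have hc : Commute (F.op RV) QV := ContinuousLinearMap.ext hcomm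
    have h1 := DFunLike.congr_fun (commute_resolvent hc hz).eq e
    refine (hQVmem _).2 ?_
    rw [mul_apply_eq_comp, mul_apply_eq_comp, (hQVmem e).1 he] at h1
    exact h1.symm

end ExactProjector

/-! ### Filter errors in terms of resolvent errors. -/

section FilterPerturbation

variable {V : Type*} [NormedAddCommGroup V] [NormedSpace ℂ V] {N : ℕ}

lemma RationalFilter.norm_op_sub_op_apply_le (F : RationalFilter N) (T T' : Fin N → V →L[ℂ] V)
    (E : Submodule ℂ V) {e : V} (he : e ∈ E) :
    ‖(F.op T' - F.op T) e‖ ≤ F.W * (⨆ k : Fin N, ‖(T k - T' k).comp E.subtypeL‖) * ‖e‖ := by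
  set s := ⨆ k : Fin N, ‖(T k - T' k).comp E.subtypeL‖ with hs
  have hle : ∀ k, ‖(T k - T' k).comp E.subtypeL‖ ≤ s := fun k =>
    le_ciSup (f := fun k => ‖(T k - T' k).comp E.subtypeL‖) (finite_range _).bddAbove k
  have hs0 : 0 ≤ s := Real.iSup_nonneg fun _ => ContinuousLinearMap.opNorm_nonneg _
  rw [RationalFilter.op_sub_op_apply]
  calc ‖∑ k : Fin N, F.w k.castSucc • (T' k - T k) e‖
      ≤ ∑ k : Fin N, ‖F.w k.castSucc‖ * (s * ‖e‖) := by
        refine norm_sum_le_of_le _ fun k _ => ?_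
        rw [norm_smul]
        gcongr
        have h1 := ((T k - T' k).comp E.subtypeL).le_of_opNorm_le (hle k) ⟨e, he⟩
        have h2 : ‖(T' k - T k) e‖ = ‖((T k - T' k).comp E.subtypeL) ⟨e, he⟩‖ := by
          rw [← neg_sub, neg_apply, norm_neg]
          rfl
        rw [h2]
        exact h1
    _ ≤ F.W * s * ‖e‖ := by
        rw [← Finset.sum_mul, mul_assoc]
        gcongr
        exact F.sum_norm_le_W

lemma iSup_norm_comp_subtypeL_le {n : ℕ} (T T' : Fin n → V →L[ℂ] V) (E : Submodule ℂ V) :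
    ⨆ k : Fin n, ‖(T k - T' k).comp E.subtypeL‖ ≤ ∑ k : Fin n, ‖T' k - T k‖ := by
  refine Real.iSup_le (fun k => ?_) (Finset.sum_nonneg fun _ _ => norm_nonneg _)
  calc ‖(T k - T' k).comp E.subtypeL‖ ≤ ‖T k - T' k‖ * ‖E.subtypeL‖ :=
        ContinuousLinearMap.opNorm_comp_le _ _
    _ ≤ ‖T k - T' k‖ := mul_le_of_le_one_right (norm_nonneg _) E.norm_subtypeL_le
    _ = ‖T' k - T k‖ := norm_sub_rev _ _
    _ ≤ _ := Finset.single_le_sum (f := fun k => ‖T' k - T k‖) (fun _ _ => norm_nonneg _)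
        (Finset.mem_univ k)

lemma RationalFilter.norm_op_sub_op_le (F : RationalFilter N) (T T' : Fin N → V →L[ℂ] V) :
    ‖F.op T' - F.op T‖ ≤ F.W * ∑ k : Fin N, ‖T' k - T k‖ := by
  have h0 : 0 ≤ ∑ k : Fin N, ‖T' k - T k‖ := Finset.sum_nonneg fun _ _ => norm_nonneg _
  refine ContinuousLinearMap.opNorm_le_bound _ (mul_nonneg F.W_nonneg h0) fun e => ?_
  refine (F.norm_op_sub_op_apply_le T T' ⊤ (Submodule.mem_top (x := e))).trans ?_
  gcongr
  · exact F.W_nonneg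
  · exact iSup_norm_comp_subtypeL_le T T' ⊤

end FilterPerturbation

end FilteredIteration

/-! ### The gap estimate and convergence. -/

open FilteredIteration in
theorem mainTheorem2 {H V : Type*}
    [NormedAddCommGroup H] [InnerProductSpace ℂ H] [CompleteSpace H]
    [NormedAddCommGroup V] [InnerProductSpace ℂ V] [CompleteSpace V]
    (A : H →ₗ.[ℂ] H) (hA : IsSelfAdjoint A)
    (Λ : Finset ℝ) (hΛ : IsEigenvalueCluster A Λ)
    {N : ℕ} (F : RationalFilter N) (hF : SeparatesSpectrum A Λ F)
    (ι : V →ₗ[ℂ] H) (hV : IsIntermediateSpace A Λ F ι)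
    (J : Set ℝ) (hJ : J ⊆ Ioi 0) (hJ0 : (0 : ℝ) ∈ closure J)
    (Vh : J → Submodule ℂ V) (Rh : J → ℂ → H →ₗ[ℂ] V)
    (RV : Fin N → V →L[ℂ] V) (RhV : J → Fin N → V →L[ℂ] V)
    (hR : IsResolventDiscretization A F ι J Vh Rh RV RhV)
    (Θ : ℝ → ℂ)
    (hΘ : IsFilterContour (F.op RV) ((fun lam : ℝ => F.r (lam : ℂ)) '' (Λ : Set ℝ)) Θ) :
    (∃ C : ℝ, 0 < C ∧ ∃ h₀ : ℝ, 0 < h₀ ∧ ∀ h : J, (h : ℝ) < h₀ →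
      (∀ t ∈ Icc (0 : ℝ) 1, Θ t ∈ resolventSet ℂ (F.op (RhV h))) ∧
      gap ((exactEigenspace A Λ).comap ι) (limitSpace Θ (F.op (RhV h))) ≤
        C * F.W *
          ⨆ k : Fin N, ‖(RV k - RhV h k).comp ((exactEigenspace A Λ).comap ι).subtypeL‖) ∧
    Tendsto (fun h : J => gap ((exactEigenspace A Λ).comap ι) (limitSpace Θ (F.op (RhV h))))
      (comap ((↑) : J → ℝ) (𝓝 0)) (𝓝 0) := by
  obtain ⟨K, hlip⟩ := hΘ.curve.lipschitz
  have hclosed := hΘ.curve.closed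
  obtain ⟨hPE, hPid, hRE⟩ := exact_spectralProjector hA hΛ hF hV hR.exact_restrict hΘ
  set E := (exactEigenspace A Λ).comap ι with hE
  set S := F.op RV with hS
  set P := spectralProjector Θ S with hP
  obtain ⟨ε, hε, L, hL, hbound⟩ := exists_resolvent_bound_near hlip
    (fun t ht => hΘ.mem_resolventSet ht)
  have hSbound := hbound S (by simpa using hε)
  set c : ℝ := ‖(2 * Real.pi * Complex.I)⁻¹‖ * K * L ^ 2 with hc
  have hc0 : 0 ≤ c := by positivity
  have hW0 := F.W_nonneg
  have hsum0 : Tendsto (fun h : J => ∑ k : Fin N, ‖RhV h k - RV k‖) (comap ((↑) : J → ℝ) (𝓝 0))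
      (𝓝 0) := by
    simpa using tendsto_finsetSum Finset.univ fun k _ => hR.tendsto k
  have hnorm0 : Tendsto (fun h : J => ‖F.op (RhV h) - S‖) (comap ((↑) : J → ℝ) (𝓝 0)) (𝓝 0) := by
    refine squeeze_zero (fun h => norm_nonneg _) (fun h => F.norm_op_sub_op_le RV (RhV h)) ?_
    simpa using hsum0.const_mul F.W
  have hop0 : Tendsto (fun h : J => F.op (RhV h)) (comap ((↑) : J → ℝ) (𝓝 0)) (𝓝 S) :=
    tendsto_iff_norm_sub_tendsto_zero.2 hnorm0
  have hspec : ∀ᶠ h : J in comap ((↑) : J → ℝ) (𝓝 0), spectrum ℂ (F.op (RhV h)) ⊆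
      {ν : ℂ | (∀ t ∈ Icc (0 : ℝ) 1, Θ t ≠ ν) ∧
        (windingNumber Θ ν = 0 ∨ windingNumber Θ ν = 1)} := by
    have h1 := (upperHemicontinuous_iff.1 (upperHemicontinuous_spectrum ℂ (V →L[ℂ] V)) S) _
      ((isOpen_setOf_windingNumber_eq_zero_or_one hlip hclosed).mem_nhdsSet.2 hΘ.spectrum_subset)
    filter_upwards [hop0.eventually h1] with h hh
    exact subset_of_mem_nhdsSet hh
  have hsmall : ∀ᶠ h : J in comap ((↑) : J → ℝ) (𝓝 0),
      c * ‖F.op (RhV h) - S‖ * (‖P‖ + 1) < 1 / 2 := by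
    have h1 := (hnorm0.const_mul c).mul_const (‖P‖ + 1)
    rw [mul_zero, zero_mul] at h1
    exact h1.eventually (gt_mem_nhds (by norm_num))
  have hmain : ∀ᶠ h : J in comap ((↑) : J → ℝ) (𝓝 0),
      (∀ t ∈ Icc (0 : ℝ) 1, Θ t ∈ resolventSet ℂ (F.op (RhV h))) ∧
      gap E (limitSpace Θ (F.op (RhV h))) ≤ ((2 * ‖P‖ + 1) * c + 1) * F.W *
        ⨆ k : Fin N, ‖(RV k - RhV h k).comp E.subtypeL‖ := by
    filter_upwards [hspec, hsmall, hnorm0.eventually (gt_mem_nhds hε)] with h h1 h2 h3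
    have hXbound := hbound _ h3
    refine ⟨fun t ht => (hXbound t ht).1, ?_⟩
    have := hR.finiteDimensional h
    have hidem : ∀ v, spectralProjector Θ (F.op (RhV h)) (spectralProjector Θ (F.op (RhV h)) v) =
        spectralProjector Θ (F.op (RhV h)) v :=
      -- After subtracting `w_N` the discrete filter maps into `V_h`.
      spectralProjector_idempotent_of_finiteRank hlip hclosed h1 (c := F.w (Fin.last N))
        (U := Vh h) fun v => by
          rw [RationalFilter.op_apply, add_sub_cancel_left]
          refine Submodule.sum_mem _ fun k _ => Submodule.smul_mem _ _ ?_
          rw [hR.discrete_restrict]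
          exact hR.range_le h k ⟨_, rfl⟩
    set s := ⨆ k : Fin N, ‖(RV k - RhV h k).comp E.subtypeL‖ with hs
    have hs0 : 0 ≤ s := Real.iSup_nonneg fun _ => ContinuousLinearMap.opNorm_nonneg _
    have hdiff : ‖spectralProjector Θ (F.op (RhV h)) - P‖ ≤ c * ‖F.op (RhV h) - S‖ := by
      refine ContinuousLinearMap.opNorm_le_bound _ (by positivity) fun e => ?_
      exact norm_spectralProjector_sub_apply_le hlip hL.le hSbound hXbound (E := ⊤)
        (fun _ _ _ _ => trivial) (norm_nonneg _) (fun e _ => ContinuousLinearMap.le_opNorm _ e)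
        trivial
    have hgap := gap_range_le (η := c * (F.W * s)) hPE hPid hidem (by positivity)
      (fun e he => norm_spectralProjector_sub_apply_le hlip hL.le hSbound hXbound
        (fun t ht => hRE _ (hSbound t ht).1) (by positivity)
        (fun e he => F.norm_op_sub_op_apply_le RV (RhV h) E he) he)
      ((mul_le_mul_of_nonneg_right hdiff (by positivity)).trans h2.le)
    calc gap E (limitSpace Θ (F.op (RhV h))) ≤ (2 * ‖P‖ + 1) * (c * (F.W * s)) := hgap
      -- The extra summand only makes the final constant positive, as `c` is merely known to be
      -- nonnegative.
      _ ≤ (2 * ‖P‖ + 1) * (c * (F.W * s)) + F.W * s := le_add_of_nonneg_right (by positivity)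
      _ = _ := by ring
  refine ⟨⟨(2 * ‖P‖ + 1) * c + 1, by positivity, ?_⟩, ?_⟩
  · rw [eventually_comap] at hmain
    obtain ⟨h₀, hh₀, hball⟩ := Metric.eventually_nhds_iff_ball.1 hmain
    refine ⟨h₀, hh₀, fun h hh => hball h ?_ h rfl⟩
    rw [mem_ball_zero_iff, Real.norm_of_nonneg (le_of_lt (hJ h.2))]
    exact hh
  · refine squeeze_zero' (Eventually.of_forall fun h => gap_nonneg _ _)
      (hmain.mono fun h hh => hh.2.trans (mul_le_mul_of_nonneg_left
        (iSup_norm_comp_subtypeL_le RV (RhV h) E) (by positivity))) ?_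
    simpa using hsum0.const_mul (((2 * ‖P‖ + 1) * c + 1) * F.W)
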